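/- Let $(M,g)$ be a closed (compact, without boundary) smooth Riemannian manifold of dimension $n$, let $g^*$ be the dual metric on $T^*M$, and let $v_g$ be the Riemannian volume. Let $\omega$ be a smooth volume on $M$, i.e. a volume form regarded as a smooth positive density (so $M$ need not be oriented). Fix a sign convention $s\in\{1,-1\}$: put $\Delta_g = s\,\mathrm{div}\,\nabla$, and let the symbol of a linear second-order differential operator $P$ be the symmetric form $\sigma_P$ on $T_x^*M$ with $\sigma_P(d\varphi_x,d\psi_x)=\tfrac{s}{2}P(\varphi\psi)(x)$ for all smooth $\varphi,\psi$ that vanish at $x$. (For both choices of $s$ the symbol of $\Delta_g$ is $g^*$.) 1. There is a unique linear differential operator $\Delta_{g,\omega}\colon C^\infty(M)\to C^\infty(M)$ of order at most two, with smooth real coefficients, such that its symbol is $g^*$, it is symmetric with respect to $\omega$, i.e. $\int_M \psi\,\Delta_{g,\omega}\varphi\;\omega=\int_M\varphi\,\Delta_{g,\omega}\psi\;\omega$ for all $\varphi,\psi\in C^\infty(M)$, and it is zero on constants. 2. There is a positive $a\in C^\infty(M)$ with $\omega=a^2v_g$. For every real-valued $a\in C^\infty(M)$ with $\omega=a^2v_g$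 and every $\varphi\in C^\infty(M)$, $$\Delta_{g,\omega}\varphi=\Delta_g\varphi+\frac{s}{a^{2}}\langle\nabla\varphi,\nabla a^2\rangle .$$ In particular $\Delta_{g,\omega}\varphi=\Delta_g\varphi-a^{-2}\langle\nabla\varphi,\nabla a^2\rangle$ in the convention $\Delta_g=-\mathrm{div}\,\nabla$ $(s=-1)$. 3. For every such $a$ (which vanishes nowhere), $Uf=af$ defines a unitary operator $U\colon L^2(M,\omega)\to L^2(M,v_g)$ of complex Hilbert spaces, and $U\Delta_{g,\omega}U^{-1}=\Delta_g+V$ with the potential $V=a\,\Delta_{g,\omega}(a^{-1})$. This holds pointwise on $C^\infty(M)$, and also as an equality of unbounded operators with domain $C^\infty(M,\mathbb C)$: $U\times U$ maps the graph of $\Delta_{g,\omega}$ in $L^2(M,\omega)\times L^2(M,\omega)$ onto the graph of $\Delta_g+V$ in $L^2(M,v_g)\times L^2(M,v_g)$. -/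

import Mathlib

open scoped Manifold ContDiff
open MeasureTheory

noncomputable section

namespace WeightedLaplace

/-- The model space `ℝⁿ`. -/
abbrev Euc (n : ℕ) : Type := EuclideanSpace ℝ (Fin n)

/-- A smooth Riemannian metric on the `n`-dimensional manifold `M`. -/
abbrev Metric (n : ℕ) (M : Type*) [TopologicalSpace M] [ChartedSpace (Euc n) M]
    [IsManifold (𝓡 n) ∞ M] :=
  Bundle.ContMDiffRiemannianMetric (𝓡 n) ∞ (Euc n) (fun x : M => TangentSpace (𝓡 n) x)

/-- A real function of `n`-tuples of tangent vectors at each point. -/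
abbrev TupleFun (n : ℕ) (M : Type*) [TopologicalSpace M] [ChartedSpace (Euc n) M] :=
  ∀ x : M, (Fin n → TangentSpace (𝓡 n) x) → ℝ

section

variable {n : ℕ} {M : Type*} [TopologicalSpace M] [ChartedSpace (Euc n) M]

/-! ### Coordinates -/

/-- The partial derivative `∂ᵢ f` on `ℝⁿ`. -/
def partialD (i : Fin n) (f : Euc n → ℝ) (y : Euc n) : ℝ :=
  fderiv ℝ f y (EuclideanSpace.single i 1)

/-- The coordinate vector field `∂ᵢ` of the chart `e`, at the point with coordinates `y`. -/
def coordVec (e : OpenPartialHomeomorph M (Euc n)) (y : Euc n) (i : Fin n) :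
    TangentSpace (𝓡 n) (e.symm y) :=
  mfderiv (𝓡 n) (𝓡 n) e.symm y (EuclideanSpace.single i (1 : ℝ) : Euc n)

/-- The coordinates, in the chart `e`, of a tangent vector at `x`. -/
def vecCoord (e : OpenPartialHomeomorph M (Euc n)) (x : M) (v : TangentSpace (𝓡 n) x) : Euc n :=
  mfderiv (𝓡 n) (𝓡 n) e x v

/-- The expression `Ω(∂₁, …, ∂ₙ)` of a density in the chart `e`. -/
def coordDensity (Ω : TupleFun n M) (e : OpenPartialHomeomorph M (Euc n)) (y : Euc n) : ℝ :=
  Ω (e.symm y) (coordVec e y)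

/-! ### Volume densities and their measures -/

/-- `Ω` is a smooth positive volume density. On an oriented manifold these are exactly the
absolute values of nowhere vanishing smooth `n`-forms. -/
structure IsVolumeDensity (Ω : TupleFun n M) : Prop where
  map_det : ∀ (x : M) (A : TangentSpace (𝓡 n) x →ₗ[ℝ] TangentSpace (𝓡 n) x)
    (v : Fin n → TangentSpace (𝓡 n) x), Ω x (fun i => A (v i)) = |LinearMap.det A| * Ω x v
  pos : ∀ (x : M) (v : Fin n → TangentSpace (𝓡 n) x), LinearIndependent ℝ v → 0 < Ω x v
  smooth : ∀ e ∈ atlas (Euc n) M, ContDiffOn ℝ ∞ (coordDensity Ω e) e.target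

/-- The measure carried by the domain of the chart `e` that is `Ω(∂₁, …, ∂ₙ) dy₁ ⋯ dyₙ` in the
coordinates of `e`. -/
def chartMeasure [MeasurableSpace M] (Ω : TupleFun n M) (e : OpenPartialHomeomorph M (Euc n)) :
    Measure M :=
  ((volume.restrict e.target).withDensity
    (fun y => ENNReal.ofReal (coordDensity Ω e y))).map e.symm

/-- The measure on `M` defined by a volume density: the least measure that dominates
`chartMeasure Ω e` for every chart `e`. Since the measures `chartMeasure Ω e` agree on overlaps and
countably many charts cover `M`, it is the measure whose restriction to the domain of each chart `e`
is `chartMeasure Ω e`. -/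
def volMeasure [MeasurableSpace M] (Ω : TupleFun n M) : Measure M :=
  ⨆ e ∈ atlas (Euc n) M, chartMeasure Ω e

/-- The divergence of a vector field `X` with respect to a volume density, computed in the
preferred chart at `x`: `ρ⁻¹ ∑ᵢ ∂ᵢ(ρ Xⁱ)` where `ρ = Ω(∂₁, …, ∂ₙ)`. -/
def divergence (Ω : TupleFun n M) (X : ∀ x : M, TangentSpace (𝓡 n) x) (x : M) : ℝ :=
  let e := chartAt (Euc n) x
  (coordDensity Ω e (e x))⁻¹ *
    ∑ i : Fin n, partialD i
      (fun y => coordDensity Ω e y * vecCoord e (e.symm y) (X (e.symm y)) i) (e x)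

/-! ### Differential operators of order two -/

/-- The differential `dφₓ` as a linear form on `TₓM`. -/
def dAt (φ : M → ℝ) (x : M) : Module.Dual ℝ (TangentSpace (𝓡 n) x) :=
  (mfderiv (𝓡 n) 𝓘(ℝ, ℝ) φ x : TangentSpace (𝓡 n) x →L[ℝ] ℝ).toLinearMap

/-- A linear operator on `C^∞(M, ℝ)` is a differential operator of order at most two, with smooth
real coefficients: in every chart it has the form `∑ Aⁱʲ ∂ᵢ∂ⱼ + ∑ Bⁱ ∂ᵢ + C`. -/
def IsDiffOpTwo (P : C^∞⟮𝓡 n, M; ℝ⟯ →ₗ[ℝ] C^∞⟮𝓡 n, M; ℝ⟯) : Prop :=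
  ∀ e ∈ atlas (Euc n) M,
    ∃ (A : Fin n → Fin n → Euc n → ℝ) (B : Fin n → Euc n → ℝ) (C : Euc n → ℝ),
      (∀ i j, ContDiffOn ℝ ∞ (A i j) e.target) ∧ (∀ i, ContDiffOn ℝ ∞ (B i) e.target) ∧
      ContDiffOn ℝ ∞ C e.target ∧
      ∀ (φ : C^∞⟮𝓡 n, M; ℝ⟯), ∀ y ∈ e.target,
        P φ (e.symm y) =
          ∑ i, ∑ j, A i j y * partialD i (partialD j (fun z => φ (e.symm z))) y
          + ∑ i, B i y * partialD i (fun z => φ (e.symm z)) y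
          + C y * φ (e.symm y)

/-- `σ` is the (principal) symbol of the second-order operator `P`: one has
`σₓ(dφ, dψ) = (s / 2) P(φψ)(x)` for all `φ`, `ψ` that vanish at `x`. For `s = 1` this is the
convention in which `∑ Aⁱʲ ∂ᵢ∂ⱼ + ⋯` has symbol `∑ Aⁱʲ ξᵢ ηⱼ` (with `A` symmetric), and for
`s = -1` the one in which the symbol is `-∑ Aⁱʲ ξᵢ ηⱼ` (`∂ⱼ` being replaced by `√(-1) ξⱼ`). -/
def HasSymbol (s : ℝ) (P : C^∞⟮𝓡 n, M; ℝ⟯ →ₗ[ℝ] C^∞⟮𝓡 n, M; ℝ⟯)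
    (σ : ∀ x : M, Module.Dual ℝ (TangentSpace (𝓡 n) x) →
      Module.Dual ℝ (TangentSpace (𝓡 n) x) → ℝ) : Prop :=
  ∀ (x : M) (φ ψ : C^∞⟮𝓡 n, M; ℝ⟯), φ x = 0 → ψ x = 0 →
    σ x (dAt φ x) (dAt ψ x) = s / 2 * P (φ * ψ) x

/-- `P` is symmetric with respect to the volume `Ω`. As `P` is real, this is equivalent to symmetry
of its complex-linear extension for the Hermitian product `∫ f ḡ Ω`. -/
def IsSymmetricFor [MeasurableSpace M] (Ω : TupleFun n M)
    (P : C^∞⟮𝓡 n, M; ℝ⟯ →ₗ[ℝ] C^∞⟮𝓡 n, M; ℝ⟯) : Prop :=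
  ∀ φ ψ : C^∞⟮𝓡 n, M; ℝ⟯,
    ∫ x, P φ x * ψ x ∂(volMeasure Ω) = ∫ x, φ x * P ψ x ∂(volMeasure Ω)

/-- The graph of the unbounded operator on the complex space `L²(M, μ)` with domain `C^∞(M, ℂ)` that
extends a real operator `P` complex-linearly: `u + iv ↦ P u + i P v`. -/
def l2Graph [MeasurableSpace M] (μ : Measure M) (P : C^∞⟮𝓡 n, M; ℝ⟯ → M → ℝ) :
    Set (Lp ℂ 2 μ × Lp ℂ 2 μ) :=
  {p | ∃ u v : C^∞⟮𝓡 n, M; ℝ⟯,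
    (p.1 =ᵐ[μ] fun x => (u x : ℂ) + Complex.I * (v x : ℂ)) ∧
    (p.2 =ᵐ[μ] fun x => (P u x : ℂ) + Complex.I * (P v x : ℂ))}

end

/-! ### Riemannian notions -/

section

variable {n : ℕ} {M : Type*} [TopologicalSpace M] [ChartedSpace (Euc n) M]
  [IsManifold (𝓡 n) ∞ M]

/-- The musical isomorphism `TₓM → TₓM*`, `v ↦ g(v, ·)`. -/
def flat (g : Metric n M) (x : M) :
    TangentSpace (𝓡 n) x ≃ₗ[ℝ] Module.Dual ℝ (TangentSpace (𝓡 n) x) :=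
  haveI : FiniteDimensional ℝ (TangentSpace (𝓡 n) x) :=
    inferInstanceAs (FiniteDimensional ℝ (Euc n))
  LinearEquiv.ofInjectiveOfFinrankEq
    ({ toFun := fun v => (g.inner x v).toLinearMap
       map_add' := fun v w => by ext; simp
       map_smul' := fun c v => by ext; simp } :
      TangentSpace (𝓡 n) x →ₗ[ℝ] Module.Dual ℝ (TangentSpace (𝓡 n) x))
    (by
      rw [injective_iff_map_eq_zero]
      intro v hv
      by_contra h
      have h1 := g.pos x v h
      have h2 : g.inner x v v = 0 := LinearMap.congr_fun hv v
      exact h1.ne' h2)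
    Subspace.dual_finrank_eq.symm

/-- The dual metric `g*` on cotangent spaces. -/
def dualMetric (g : Metric n M) (x : M) (ξ η : Module.Dual ℝ (TangentSpace (𝓡 n) x)) : ℝ :=
  g.inner x ((flat g x).symm ξ) ((flat g x).symm η)

/-- The gradient `∇φ`, characterized by `g(∇φ, ·) = dφ`. -/
def grad (g : Metric n M) (φ : M → ℝ) (x : M) : TangentSpace (𝓡 n) x :=
  (flat g x).symm (dAt φ x)

/-- The Riemannian volume density `√det(g(vᵢ, vⱼ))`. -/
def riemDensity (g : Metric n M) : TupleFun n M :=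
  fun x v => Real.sqrt (Matrix.det (Matrix.of fun i j => g.inner x (v i) (v j)))

/-- The operator `div ∇` of the metric `g`. -/
def divGrad (g : Metric n M) (φ : M → ℝ) (x : M) : ℝ :=
  divergence (riemDensity g) (grad g φ) x

/-- `P` is a second-order differential operator with real coefficients whose symbol is `g*` (in the
sign convention `s`), that is symmetric with respect to `Ω` and zero on constants. -/
structure IsWeightedLaplacian [MeasurableSpace M] (s : ℝ) (g : Metric n M) (Ω : TupleFun n M)
    (P : C^∞⟮𝓡 n, M; ℝ⟯ →ₗ[ℝ] C^∞⟮𝓡 n, M; ℝ⟯) : Prop where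
  diffOp : IsDiffOpTwo P
  symbol : HasSymbol s P (dualMetric g)
  symmetric : IsSymmetricFor Ω P
  const : ∀ φ : C^∞⟮𝓡 n, M; ℝ⟯, (∃ c : ℝ, ∀ x, φ x = c) → P φ = 0

end

end WeightedLaplace

end

open WeightedLaplace

/-! The operator is `s div_Ω ∇`, where in a chart `div_Ω X = ρ⁻¹ ∑ ∂ᵢ(ρ Xⁱ)` and `ρ` is the
coordinate expression of `Ω`. The analytic core is the divergence theorem `∫ ψ div_Ω X Ω = -∫ dψ(X)
Ω` (`integral_mul_divergence`): integration by parts in one chart, globalized by a partition of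
unity. It rests on `volMeasure_restrict`, by which the measure of `Ω` is `ρ dy` in each chart. The
same integration by parts shows that the divergence is independent of the chart (`chartDiv_congr`),
since the right-hand side mentions no chart.

Existence. By the divergence theorem `∫ φ Pψ Ω = -s ∫ ⟨∇φ, ∇ψ⟩ Ω`, which is symmetric. The Leibniz
rule `P(φψ) = φ Pψ + ψ Pφ + 2s ⟨∇φ, ∇ψ⟩` gives the symbol, because `s² = 1`.

Uniqueness. The difference `D` of two solutions kills constants and, at `x`, every product of two
functions vanishing at `x`; hence it is a derivation. Symmetry gives `∫ D(φψ) = ∫ φψ D1 = 0`, so by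
Leibniz and symmetry again `2 ∫ ψ Dφ = 0`. Taking `ψ = Dφ` yields `Dφ = 0`.

Comparison with `Δ_g`. Replacing a density by `f` times itself adds `f⁻¹ df(X)` to the divergence;
`f = a²` gives the drift term. Under conjugation by `a`, the first-order terms cancel because `d(a
a⁻¹) = 0`, leaving a potential. Unitarity is the identity `|af|² v_g = |f|² Ω`, and the graphs
correspond because multiplication by `a` is a bijection of the smooth functions. -/

noncomputable section

namespace WeightedLaplace

section

variable {n : ℕ} {M : Type*} [TopologicalSpace M] [ChartedSpace (Euc n) M]

/-! ### The derivative of a chart -/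

/-- The derivative of a chart at `x`, as an endomorphism of the model space. -/
def chartD (e : OpenPartialHomeomorph M (Euc n)) (x : M) : Euc n →L[ℝ] Euc n :=
  mfderiv (𝓡 n) (𝓡 n) e x

/-- The derivative of an inverse chart at `y`, as an endomorphism of the model space. -/
def chartDSymm (e : OpenPartialHomeomorph M (Euc n)) (y : Euc n) : Euc n →L[ℝ] Euc n :=
  mfderiv (𝓡 n) (𝓡 n) e.symm y

/-- The derivative of a function at `x`, as a linear form on the model space. -/
def covec (φ : M → ℝ) (x : M) : Euc n →L[ℝ] ℝ :=
  mfderiv (𝓡 n) 𝓘(ℝ, ℝ) φ x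

section

variable [IsManifold (𝓡 n) ∞ M] {e e' : OpenPartialHomeomorph M (Euc n)}

theorem mdifferentiable_chart (he : e ∈ atlas (Euc n) M) :
    e.MDifferentiable (𝓡 n) (𝓡 n) :=
  haveI : IsManifold (𝓡 n) 1 M := IsManifold.of_le (n := ∞) (by simp)
  mdifferentiable_of_mem_atlas he

theorem chartDSymm_chartD (he : e ∈ atlas (Euc n) M) {x : M} (hx : x ∈ e.source) (v : Euc n) :
    chartDSymm e (e x) (chartD e x v) = v :=
  DFunLike.congr_fun ((mdifferentiable_chart he).symm_comp_deriv hx) v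

theorem chartD_chartDSymm (he : e ∈ atlas (Euc n) M) {y : Euc n} (hy : y ∈ e.target)
    (v : Euc n) : chartD e (e.symm y) (chartDSymm e y v) = v :=
  DFunLike.congr_fun ((mdifferentiable_chart he).comp_symm_deriv hy) v

theorem hasMFDerivAt_chart_symm (he : e ∈ atlas (Euc n) M) {y : Euc n} (hy : y ∈ e.target) :
    HasMFDerivAt (𝓡 n) (𝓡 n) e.symm y (chartDSymm e y) :=
  ((mdifferentiable_chart he).mdifferentiableAt_symm hy).hasMFDerivAt

theorem hasMFDerivAt_chart (he : e ∈ atlas (Euc n) M) {x : M} (hx : x ∈ e.source) :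
    HasMFDerivAt (𝓡 n) (𝓡 n) e x (chartD e x) :=
  ((mdifferentiable_chart he).mdifferentiableAt hx).hasMFDerivAt

theorem hasFDerivAt_transition (he : e ∈ atlas (Euc n) M) (he' : e' ∈ atlas (Euc n) M) {y : Euc n}
    (hy : y ∈ e.target) (hy' : e.symm y ∈ e'.source) :
    HasFDerivAt (fun z => e' (e.symm z)) (chartD e' (e.symm y) ∘L chartDSymm e y) y :=
  (HasMFDerivAt.comp y (hasMFDerivAt_chart he' hy') (hasMFDerivAt_chart_symm he hy)).hasFDerivAt

theorem hasFDerivAt_comp_chart_symm (he : e ∈ atlas (Euc n) M) {y : Euc n} (hy : y ∈ e.target)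
    {φ : M → ℝ} (hφ : MDifferentiableAt (𝓡 n) 𝓘(ℝ, ℝ) φ (e.symm y)) :
    HasFDerivAt (fun z => φ (e.symm z))
      (covec φ (e.symm y) ∘L chartDSymm e y) y :=
  (HasMFDerivAt.comp y hφ.hasMFDerivAt (hasMFDerivAt_chart_symm he hy)).hasFDerivAt

theorem partialD_comp_chart_symm (he : e ∈ atlas (Euc n) M) {y : Euc n} (hy : y ∈ e.target)
    {φ : M → ℝ} (hφ : MDifferentiableAt (𝓡 n) 𝓘(ℝ, ℝ) φ (e.symm y)) (i : Fin n) :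
    partialD i (fun z => φ (e.symm z)) y = dAt φ (e.symm y) (coordVec e y i) :=
  DFunLike.congr_fun (hasFDerivAt_comp_chart_symm he hy hφ).fderiv _

theorem eq_sum_single (v : Euc n) : v = ∑ i, v i • EuclideanSpace.single i (1 : ℝ) := by
  ext j
  simp [Finset.sum_apply, Pi.single_apply]

/-- A tangent vector is the combination of the coordinate vectors given by its coordinates. -/
theorem eq_sum_coordVec (he : e ∈ atlas (Euc n) M) {y : Euc n} (hy : y ∈ e.target)
    (v : TangentSpace (𝓡 n) (e.symm y)) :
    v = ∑ i, vecCoord e (e.symm y) v i • coordVec e y i := by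
  have h : chartDSymm e y (chartD e (e.symm y) v) = v := by
    have := chartDSymm_chartD he (e.map_target hy) v
    rwa [e.right_inv hy] at this
  conv_lhs => rw [← h, eq_sum_single (chartD e (e.symm y) v), map_sum]
  exact Finset.sum_congr rfl fun i _ => map_smul (chartDSymm e y) _ _

theorem dAt_eq_sum (he : e ∈ atlas (Euc n) M) {y : Euc n} (hy : y ∈ e.target)
    {φ : M → ℝ} (hφ : MDifferentiableAt (𝓡 n) 𝓘(ℝ, ℝ) φ (e.symm y))
    (v : TangentSpace (𝓡 n) (e.symm y)) :
    dAt φ (e.symm y) v =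
      ∑ i, vecCoord e (e.symm y) v i * partialD i (fun z => φ (e.symm z)) y := by
  conv_lhs => rw [eq_sum_coordVec he hy v, map_sum]
  refine Finset.sum_congr rfl fun i _ => ?_
  rw [partialD_comp_chart_symm he hy hφ, map_smul, smul_eq_mul]

theorem linearIndependent_coordVec (he : e ∈ atlas (Euc n) M) {y : Euc n} (hy : y ∈ e.target) :
    LinearIndependent ℝ (coordVec e y) := by
  have h : LinearIndependent ℝ (fun i : Fin n => (EuclideanSpace.single i (1 : ℝ) : Euc n)) := by
    have := (EuclideanSpace.basisFun (Fin n) ℝ).toBasis.linearIndependent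
    rwa [show ⇑(EuclideanSpace.basisFun (Fin n) ℝ).toBasis =
      fun i : Fin n => (EuclideanSpace.single i (1 : ℝ) : Euc n) by ext1 i; simp] at this
  have hinj : Function.Injective (chartDSymm e y) := fun v w hvw => by
    rw [← chartD_chartDSymm he hy v, hvw, chartD_chartDSymm he hy]
  exact h.map' (chartDSymm e y).toLinearMap (LinearMap.ker_eq_bot.mpr hinj)

theorem coordDensity_pos {Ω : TupleFun n M} (hΩ : IsVolumeDensity Ω) (he : e ∈ atlas (Euc n) M)
    {y : Euc n} (hy : y ∈ e.target) : 0 < coordDensity Ω e y :=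
  hΩ.pos _ _ (linearIndependent_coordVec he hy)

/-- Change of charts for a density. -/
theorem coordDensity_transition {Ω : TupleFun n M} (hΩ : IsVolumeDensity Ω)
    (he' : e' ∈ atlas (Euc n) M) {y : Euc n} (hy' : e.symm y ∈ e'.source) :
    coordDensity Ω e y =
      |(chartD e' (e.symm y) ∘L chartDSymm e y).det| * coordDensity Ω e' (e' (e.symm y)) := by
  set x := e.symm y with hx
  have key : coordDensity Ω e' (e' x) =
      Ω x (fun i => (chartDSymm e' (e' x) (EuclideanSpace.single i 1) : Euc n)) := by
    -- The type of the tuple depends on the base point, and `e'.symm (e' x)` equals `x` only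
    -- propositionally; a free `z` makes the transport trivial.
    have aux : ∀ z : M, z = x →
        Ω z (fun i => (chartDSymm e' (e' x) (EuclideanSpace.single i 1) : Euc n)) =
        Ω x (fun i => (chartDSymm e' (e' x) (EuclideanSpace.single i 1) : Euc n)) := by
      rintro z rfl; rfl
    exact aux _ (e'.left_inv hy')
  -- `A` carries the coordinate frame of `e'` to that of `e`. Its determinant is the Jacobian of the
  -- transition map, the two factors being composed in the other order.
  let A : TangentSpace (𝓡 n) x →ₗ[ℝ] TangentSpace (𝓡 n) x :=
    ((chartDSymm e y ∘L chartD e' x : Euc n →L[ℝ] Euc n) : Euc n →ₗ[ℝ] Euc n)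
  have h1 := hΩ.map_det x A
    (fun i => (chartDSymm e' (e' x) (EuclideanSpace.single i 1) : Euc n))
  rw [key]
  have h2 : LinearMap.det A = (chartD e' x ∘L chartDSymm e y).det := by
    change LinearMap.det ((chartDSymm e y : Euc n →ₗ[ℝ] Euc n) ∘ₗ (chartD e' x : Euc n →ₗ[ℝ] Euc n))
      = LinearMap.det ((chartD e' x : Euc n →ₗ[ℝ] Euc n) ∘ₗ (chartDSymm e y : Euc n →ₗ[ℝ] Euc n))
    rw [LinearMap.det_comp, LinearMap.det_comp, mul_comm]
  rw [← h2, ← h1, coordDensity]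
  congr 1
  ext1 i
  change _ = chartDSymm e y (chartD e' x (chartDSymm e' (e' x) _))
  have h3 : chartD e' x (chartDSymm e' (e' x) (EuclideanSpace.single i 1)) =
      EuclideanSpace.single i 1 := by
    have := chartD_chartDSymm he' (e'.map_source hy') (EuclideanSpace.single i 1)
    rwa [e'.left_inv hy'] at this
  rw [h3]
  rfl

end

end

section

variable {n : ℕ} {M : Type*} [TopologicalSpace M] [ChartedSpace (Euc n) M]
  [IsManifold (𝓡 n) ∞ M] [MeasurableSpace M] [BorelSpace M]
  {Ω : TupleFun n M} {e e' : OpenPartialHomeomorph M (Euc n)}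

/-! ### The measure of a density -/

section

omit [IsManifold (𝓡 n) ∞ M]

omit [ChartedSpace (Euc n) M] in
theorem aemeasurable_chart_symm (e : OpenPartialHomeomorph M (Euc n)) (f : Euc n → ENNReal) :
    AEMeasurable e.symm ((volume.restrict e.target).withDensity f) :=
  (e.continuousOn_symm.aemeasurable e.open_target.measurableSet).mono_ac
    (withDensity_absolutelyContinuous _ _)

omit [MeasurableSpace M] [BorelSpace M] in
theorem aemeasurable_coordDensity (hΩ : IsVolumeDensity Ω) (he : e ∈ atlas (Euc n) M) :
    AEMeasurable (coordDensity Ω e) (volume.restrict e.target) :=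
  (hΩ.smooth e he).continuousOn.aemeasurable e.open_target.measurableSet

theorem lintegral_chartMeasure (hΩ : IsVolumeDensity Ω) (he : e ∈ atlas (Euc n) M)
    {f : M → ENNReal} (hf : Measurable f) :
    ∫⁻ x, f x ∂(chartMeasure Ω e) =
      ∫⁻ y in e.target, ENNReal.ofReal (coordDensity Ω e y) * f (e.symm y) := by
  rw [chartMeasure, lintegral_map' hf.aemeasurable (aemeasurable_chart_symm e _),
    lintegral_withDensity_eq_lintegral_mul₀ (aemeasurable_coordDensity hΩ he).ennreal_ofReal]
  · rfl
  · exact hf.comp_aemeasurable (e.continuousOn_symm.aemeasurable e.open_target.measurableSet)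

theorem setLIntegral_eq_of_forall_diff_eq_zero {α : Type*} [MeasurableSpace α] {μ : Measure α}
    {s t : Set α} (hs : MeasurableSet s) (ht : MeasurableSet t) (hst : s ⊆ t) {f : α → ENNReal}
    (hf : ∀ x ∈ t, x ∉ s → f x = 0) : ∫⁻ x in t, f x ∂μ = ∫⁻ x in s, f x ∂μ := by
  rw [← lintegral_indicator hs, ← lintegral_indicator ht]
  congr 1
  ext x
  by_cases hx : x ∈ s
  · rw [Set.indicator_of_mem hx, Set.indicator_of_mem (hst hx)]
  · rw [Set.indicator_of_notMem hx]
    by_cases hx' : x ∈ t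
    · rw [Set.indicator_of_mem hx', hf x hx' hx]
    · rw [Set.indicator_of_notMem hx']

theorem integral_chartMeasure (hΩ : IsVolumeDensity Ω)
    (hpos : ∀ y ∈ e.target, 0 < coordDensity Ω e y) (he : e ∈ atlas (Euc n) M)
    {f : M → ℝ} (hf : Continuous f) :
    ∫ x, f x ∂(chartMeasure Ω e) = ∫ y in e.target, coordDensity Ω e y * f (e.symm y) := by
  rw [chartMeasure, integral_map (aemeasurable_chart_symm e _) hf.aestronglyMeasurable,
    integral_withDensity_eq_integral_toReal_smul₀ (aemeasurable_coordDensity hΩ he).ennreal_ofReal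
      (Filter.Eventually.of_forall fun _ => ENNReal.ofReal_lt_top)]
  refine setIntegral_congr_fun e.open_target.measurableSet fun y hy => ?_
  simp only [smul_eq_mul]
  rw [ENNReal.toReal_ofReal (hpos y hy).le]

end

/-- Two chart measures agree on functions that vanish off the overlap of the charts. -/
theorem lintegral_chartMeasure_congr (hΩ : IsVolumeDensity Ω) (he : e ∈ atlas (Euc n) M)
    (he' : e' ∈ atlas (Euc n) M) {f : M → ENNReal} (hf : Measurable f)
    (h0 : ∀ x, x ∉ e.source ∩ e'.source → f x = 0) :
    ∫⁻ x, f x ∂(chartMeasure Ω e') = ∫⁻ x, f x ∂(chartMeasure Ω e) := by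
  rw [lintegral_chartMeasure hΩ he hf, lintegral_chartMeasure hΩ he' hf]
  set T := e.symm.trans e' with hT
  have hS : T.source = e.target ∩ e.symm ⁻¹' e'.source := by simp [hT]
  have hS' : T.target = e'.target ∩ e'.symm ⁻¹' e.source := by simp [hT]
  -- Both integrals shrink to the overlap, where the change of variables along `T` produces exactly
  -- the Jacobian in `coordDensity_transition`.
  rw [setLIntegral_eq_of_forall_diff_eq_zero (s := T.source) T.open_source.measurableSet
      e.open_target.measurableSet (by rw [hS]; exact Set.inter_subset_left),
    setLIntegral_eq_of_forall_diff_eq_zero (s := T.target) T.open_target.measurableSet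
      e'.open_target.measurableSet (by rw [hS']; exact Set.inter_subset_left),
    ← T.image_source_eq_target,
    lintegral_image_eq_lintegral_abs_det_fderiv_mul volume T.open_source.measurableSet
      (f' := fun y => chartD e' (e.symm y) ∘L chartDSymm e y) _ T.injOn]
  · refine setLIntegral_congr_fun T.open_source.measurableSet fun y hy => ?_
    rw [hS] at hy
    have hTy : T y = e' (e.symm y) := rfl
    rw [coordDensity_transition hΩ he' hy.2, ENNReal.ofReal_mul (abs_nonneg _), mul_assoc, hTy,
      e'.left_inv hy.2]
  · intro y hy
    rw [hS] at hy
    exact (hasFDerivAt_transition he he' hy.1 hy.2).hasFDerivWithinAt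
  · intro y hy hy'
    rw [h0, mul_zero]
    rintro ⟨h1, -⟩
    exact hy' (by rw [hS']; exact ⟨hy, h1⟩)
  · intro y hy hy'
    rw [h0, mul_zero]
    rintro ⟨-, h1⟩
    exact hy' (by rw [hS]; exact ⟨hy, h1⟩)

omit [IsManifold (𝓡 n) ∞ M] in
theorem chartMeasure_compl_source (hΩ : IsVolumeDensity Ω) (he : e ∈ atlas (Euc n) M) :
    chartMeasure Ω e e.sourceᶜ = 0 := by
  have hm := e.open_source.measurableSet.compl
  rw [← lintegral_indicator_one hm, lintegral_chartMeasure hΩ he (measurable_one.indicator hm)]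
  refine setLIntegral_eq_zero e.open_target.measurableSet fun y hy => ?_
  simp [e.map_target hy]

/-- Only an inequality can hold: `chartMeasure Ω e'` sees just the part of `A` inside `e'.source`,
where the two measures agree. -/
theorem chartMeasure_apply_le (hΩ : IsVolumeDensity Ω) (he : e ∈ atlas (Euc n) M)
    (he' : e' ∈ atlas (Euc n) M) {A : Set M} (hA : MeasurableSet A) (hAe : A ⊆ e.source) :
    chartMeasure Ω e' A ≤ chartMeasure Ω e A := by
  have hm := hA.inter e'.open_source.measurableSet
  calc chartMeasure Ω e' A ≤ chartMeasure Ω e' (A ∩ e'.source) + chartMeasure Ω e' e'.sourceᶜ :=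
        (measure_mono (fun x hx => by
          by_cases h : x ∈ e'.source
          exacts [Or.inl ⟨hx, h⟩, Or.inr h])).trans (measure_union_le _ _)
    _ = chartMeasure Ω e' (A ∩ e'.source) := by rw [chartMeasure_compl_source hΩ he', add_zero]
    _ = chartMeasure Ω e (A ∩ e'.source) := by
        rw [← lintegral_indicator_one hm, ← lintegral_indicator_one hm,
          lintegral_chartMeasure_congr hΩ he he' (measurable_one.indicator hm)]
        intro x hx
        exact Set.indicator_of_notMem (fun h => hx ⟨hAe h.1, h.2⟩) _
    _ ≤ chartMeasure Ω e A := measure_mono Set.inter_subset_left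

/-- The measure of a density restricts to the chart measure on the domain of each chart. -/
theorem volMeasure_restrict (hΩ : IsVolumeDensity Ω) (he : e ∈ atlas (Euc n) M) :
    (volMeasure Ω).restrict e.source = chartMeasure Ω e := by
  have hS := e.open_source.measurableSet
  have hle : chartMeasure Ω e ≤ volMeasure Ω :=
    le_iSup₂ (f := fun (e : OpenPartialHomeomorph M (Euc n)) (_ : e ∈ atlas (Euc n) M) =>
      chartMeasure Ω e) e he
  refine le_antisymm ?_ ?_
  -- The right-hand side dominates every chart measure, hence their supremum; on subsets of
  -- `e.source` its second summand vanishes.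
  · have h : volMeasure Ω ≤ chartMeasure Ω e + (volMeasure Ω).restrict e.sourceᶜ := by
      refine iSup₂_le fun e' he' => Measure.le_iff.mpr fun A hA => ?_
      rw [Measure.add_apply, Measure.restrict_apply hA, ← measure_inter_add_sdiff A hS]
      refine add_le_add ?_ ?_
      · exact (chartMeasure_apply_le hΩ he he' (hA.inter hS) Set.inter_subset_right).trans
          (measure_mono Set.inter_subset_left)
      · exact le_iSup₂ (f := fun (e : OpenPartialHomeomorph M (Euc n))
          (_ : e ∈ atlas (Euc n) M) => chartMeasure Ω e) e' he' _
    refine Measure.le_iff.mpr fun A hA => ?_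
    rw [Measure.restrict_apply hA]
    refine (h _).trans ?_
    rw [Measure.add_apply, Measure.restrict_apply (hA.inter hS)]
    have : A ∩ e.source ∩ e.sourceᶜ = ∅ := by rw [Set.inter_assoc]; simp
    rw [this, measure_empty, add_zero]
    exact measure_mono Set.inter_subset_left
  · refine Measure.le_iff.mpr fun A hA => ?_
    rw [Measure.restrict_apply hA]
    calc chartMeasure Ω e A ≤ chartMeasure Ω e (A ∩ e.source) + chartMeasure Ω e e.sourceᶜ :=
          (measure_mono (fun x hx => by
            by_cases h : x ∈ e.source
            exacts [Or.inl ⟨hx, h⟩, Or.inr h])).trans (measure_union_le _ _)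
      _ = chartMeasure Ω e (A ∩ e.source) := by rw [chartMeasure_compl_source hΩ he, add_zero]
      _ ≤ volMeasure Ω (A ∩ e.source) := hle _

theorem integral_volMeasure_of_support (hΩ : IsVolumeDensity Ω) (he : e ∈ atlas (Euc n) M)
    {f : M → ℝ} (hf : Continuous f) (h0 : ∀ x, x ∉ e.source → f x = 0) :
    ∫ x, f x ∂(volMeasure Ω) = ∫ y in e.target, coordDensity Ω e y * f (e.symm y) := by
  rw [← integral_chartMeasure hΩ (fun y hy => coordDensity_pos hΩ he hy) he hf,
    ← volMeasure_restrict hΩ he, setIntegral_eq_integral_of_forall_compl_eq_zero h0]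

/-- By compactness local finiteness suffices, and near a point the coordinate density is bounded on
a compact set of coordinates. -/
theorem isFiniteMeasure_volMeasure [CompactSpace M] (hΩ : IsVolumeDensity Ω) :
    IsFiniteMeasure (volMeasure Ω) := by
  refine ⟨isCompact_univ.measure_lt_top_of_nhdsWithin fun x _ => ?_⟩
  rw [nhdsWithin_univ]
  set e := chartAt (Euc n) x with he'
  have he : e ∈ atlas (Euc n) M := chart_mem_atlas _ x
  have hx : x ∈ e.source := mem_chart_source _ x
  have hc : ContinuousAt (fun z => coordDensity Ω e (e z)) x :=
    (((hΩ.smooth e he).continuousOn.continuousAt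
      (e.open_target.mem_nhds (e.map_source hx))).comp (e.continuousAt hx))
  obtain ⟨K, hK, hKc, hKt⟩ := exists_compact_subset e.open_target (e.map_source hx)
  have hU : e.source ∩ e ⁻¹' interior K ∈ nhds x :=
    (e.isOpen_inter_preimage isOpen_interior).mem_nhds ⟨hx, hKc⟩
  refine ⟨_, hU, ?_⟩
  have hm : MeasurableSet (e.source ∩ e ⁻¹' interior K) :=
    (e.isOpen_inter_preimage isOpen_interior).measurableSet
  have h1 : volMeasure Ω (e.source ∩ e ⁻¹' interior K) =
      chartMeasure Ω e (e.source ∩ e ⁻¹' interior K) := by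
    rw [← volMeasure_restrict hΩ he, Measure.restrict_apply hm]
    congr 1
    exact (Set.inter_eq_left.mpr Set.inter_subset_left).symm
  rw [h1, ← lintegral_indicator_one hm,
    lintegral_chartMeasure hΩ he (measurable_one.indicator hm)]
  obtain ⟨C, hC⟩ := hK.exists_bound_of_continuousOn ((hΩ.smooth e he).continuousOn.mono hKt)
  calc _ ≤ ∫⁻ y in e.target, K.indicator (fun _ => ENNReal.ofReal C) y := by
        refine lintegral_mono_ae ((ae_restrict_iff' e.open_target.measurableSet).mpr
          (Filter.Eventually.of_forall fun y hy => ?_))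
        by_cases hy' : e.symm y ∈ e.source ∩ e ⁻¹' interior K
        · have hyK : y ∈ K := interior_subset (by simpa [e.right_inv hy] using hy'.2)
          rw [Set.indicator_of_mem hy', Set.indicator_of_mem hyK, Pi.one_apply, mul_one]
          exact ENNReal.ofReal_le_ofReal ((le_abs_self _).trans (hC y hyK))
        · rw [Set.indicator_of_notMem hy', mul_zero]
          exact zero_le
    _ ≤ ∫⁻ y, K.indicator (fun _ => ENNReal.ofReal C) y := setLIntegral_le_lintegral _ _
    _ = ENNReal.ofReal C * volume K := lintegral_indicator_const hK.measurableSet _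
    _ < ⊤ := ENNReal.mul_lt_top ENNReal.ofReal_lt_top hK.measure_lt_top

/-- The coordinate density is strictly positive, so a null open set containing `x` would give a
nonempty open null set in `ℝⁿ`. -/
theorem isOpenPosMeasure_volMeasure (hΩ : IsVolumeDensity Ω) :
    (volMeasure Ω).IsOpenPosMeasure := by
  refine ⟨fun U hU ⟨x, hxU⟩ h0 => ?_⟩
  set e := chartAt (Euc n) x with he'
  have he : e ∈ atlas (Euc n) M := chart_mem_atlas _ x
  have hx : x ∈ e.source := mem_chart_source _ x
  have h1 : chartMeasure Ω e U = 0 := by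
    rw [← volMeasure_restrict hΩ he]
    exact le_antisymm ((Measure.restrict_apply_le _ _).trans h0.le) zero_le
  have hV : IsOpen (e.target ∩ e.symm ⁻¹' U) := e.isOpen_inter_preimage_symm hU
  have hm : MeasurableSet (e.target ∩ e.symm ⁻¹' U) := hV.measurableSet
  rw [← lintegral_indicator_one hU.measurableSet,
    lintegral_chartMeasure hΩ he (measurable_one.indicator hU.measurableSet)] at h1
  have h2 : ∫⁻ y in e.target ∩ e.symm ⁻¹' U, ENNReal.ofReal (coordDensity Ω e y) = 0 := by
    rw [← h1, setLIntegral_eq_of_forall_diff_eq_zero hm e.open_target.measurableSet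
      Set.inter_subset_left]
    · refine setLIntegral_congr_fun hm fun y hy => ?_
      rw [Set.indicator_of_mem (s := U) hy.2, Pi.one_apply, mul_one]
    · intro y hy hy'
      rw [Set.indicator_of_notMem (s := U) fun h => hy' ⟨hy, h⟩, mul_zero]
  rw [lintegral_eq_zero_iff' (((aemeasurable_coordDensity hΩ he).mono_set
    Set.inter_subset_left).ennreal_ofReal), Filter.EventuallyEq, ae_restrict_iff' hm] at h2
  have h3 : volume (e.target ∩ e.symm ⁻¹' U) = 0 := by
    refine measure_mono_null (fun y hy => ?_) (ae_iff.mp h2)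
    simp only [Pi.zero_apply, ENNReal.ofReal_eq_zero, not_le, Set.mem_ofPred_eq, Classical.not_imp]
    exact ⟨hy, coordDensity_pos hΩ he hy.1⟩
  exact hV.measure_ne_zero volume ⟨e x, e.map_source hx, by simpa [e.left_inv hx] using hxU⟩ h3

end

section

/-! ### Integration by parts -/

section

variable {n : ℕ} {U : Set (Euc n)}

theorem contDiffOn_partialD (hU : IsOpen U) {f : Euc n → ℝ} (hf : ContDiffOn ℝ ∞ f U)
    (i : Fin n) : ContDiffOn ℝ ∞ (partialD i f) U :=
  (hf.fderiv_of_isOpen hU (by simp)).clm_apply contDiffOn_const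

theorem partialD_congr (hU : IsOpen U) {f f' : Euc n → ℝ} (h : Set.EqOn f f' U) {y : Euc n}
    (hy : y ∈ U) (i : Fin n) : partialD i f y = partialD i f' y := by
  rw [partialD, partialD, (h.eventuallyEq_of_mem (hU.mem_nhds hy)).fderiv_eq]

theorem partialD_mul {f f' : Euc n → ℝ} {y : Euc n} (hf : DifferentiableAt ℝ f y)
    (hf' : DifferentiableAt ℝ f' y) (i : Fin n) :
    partialD i (fun z => f z * f' z) y = f y * partialD i f' y + f' y * partialD i f y := by
  simp [partialD, fderiv_fun_mul hf hf']

theorem partialD_sum {ι : Type*} [Fintype ι] {f : ι → Euc n → ℝ} {y : Euc n}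
    (hf : ∀ j, DifferentiableAt ℝ (f j) y) (i : Fin n) :
    partialD i (fun z => ∑ j, f j z) y = ∑ j, partialD i (f j) y := by
  simp [partialD, fderiv_fun_sum fun j _ => hf j]

/-- Chart expressions are meaningful only on the chart domain; a factor supported there makes the
product continuous everywhere, so that it can be integrated globally. -/
theorem continuous_mul_of_tsupport_subset {X : Type*} [TopologicalSpace X] {V : Set X}
    (hV : IsOpen V) {f g : X → ℝ} (hg : Continuous g) (hgV : tsupport g ⊆ V)
    (hf : ContinuousOn f V) : Continuous fun x => g x * f x :=
  (hg.continuousOn.mul hf).continuous_of_tsupport_subset hV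
    ((tsupport_mul_subset_left (f := g) (g := f)).trans hgV)

/-- No boundary term appears: `Ψ` vanishes off a compact subset of `U`, so both integrals extend to
`ℝⁿ` and the values of `F` outside `U` are irrelevant. -/
theorem setIntegral_mul_partialD (hU : IsOpen U) {F Ψ : Euc n → ℝ} (hF : ContDiffOn ℝ ∞ F U)
    (hΨ : ContDiff ℝ ∞ Ψ) (hc : HasCompactSupport Ψ) (hΨU : tsupport Ψ ⊆ U) (i : Fin n) :
    ∫ y in U, Ψ y * partialD i F y = -∫ y in U, partialD i Ψ y * F y := by
  have hdΨ : Continuous (partialD i Ψ) :=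
    (hΨ.continuous_fderiv (by simp)).clm_apply continuous_const
  have hdc : HasCompactSupport (partialD i Ψ) := hc.fderiv_apply ℝ _
  have hdU : tsupport (partialD i Ψ) ⊆ U := (tsupport_fderiv_apply_subset ℝ _).trans hΨU
  have h0 : ∀ y, y ∉ U → Ψ y = 0 := fun y hy =>
    image_eq_zero_of_notMem_tsupport fun h => hy (hΨU h)
  have hd0 : ∀ y, y ∉ U → partialD i Ψ y = 0 := fun y hy =>
    image_eq_zero_of_notMem_tsupport fun h => hy (hdU h)
  rw [setIntegral_eq_integral_of_forall_compl_eq_zero fun y hy => by rw [h0 y hy, zero_mul],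
    setIntegral_eq_integral_of_forall_compl_eq_zero fun y hy => by rw [hd0 y hy, zero_mul]]
  refine integral_mul_fderiv_eq_neg_fderiv_mul_of_integrable ?_ ?_ ?_ ?_ ?_
  · exact (continuous_mul_of_tsupport_subset hU hdΨ hdU
      hF.continuousOn).integrable_of_hasCompactSupport hdc.mul_right
  · exact (continuous_mul_of_tsupport_subset hU hΨ.continuous hΨU
      (contDiffOn_partialD hU hF i).continuousOn).integrable_of_hasCompactSupport hc.mul_right
  · exact (continuous_mul_of_tsupport_subset hU hΨ.continuous hΨU
      hF.continuousOn).integrable_of_hasCompactSupport hc.mul_right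
  · exact fun y _ => (hΨ.differentiable (by simp)) y
  · exact fun y hy => (hF.contDiffAt (hU.mem_nhds (hΨU hy))).differentiableAt (by simp)

end

variable {n : ℕ} {M : Type*} [TopologicalSpace M] [ChartedSpace (Euc n) M]

section

variable [IsManifold (𝓡 n) ∞ M] {e e' : OpenPartialHomeomorph M (Euc n)}

/-! ### Smoothness in charts -/

theorem contMDiffOn_chart (he : e ∈ atlas (Euc n) M) :
    ContMDiffOn (𝓡 n) (𝓡 n) ∞ e e.source :=
  contMDiffOn_of_mem_maximalAtlas (IsManifold.subset_maximalAtlas he)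

theorem contMDiffOn_chart_symm (he : e ∈ atlas (Euc n) M) :
    ContMDiffOn (𝓡 n) (𝓡 n) ∞ e.symm e.target :=
  contMDiffOn_symm_of_mem_maximalAtlas (IsManifold.subset_maximalAtlas he)

theorem contDiffOn_comp_chart_symm (he : e ∈ atlas (Euc n) M) {φ : M → ℝ}
    (hφ : ContMDiff (𝓡 n) 𝓘(ℝ, ℝ) ∞ φ) : ContDiffOn ℝ ∞ (fun y => φ (e.symm y)) e.target :=
  contMDiffOn_iff_contDiffOn.mp (hφ.comp_contMDiffOn (contMDiffOn_chart_symm he))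

theorem contMDiffOn_comp_chart (he : e ∈ atlas (Euc n) M) {f : Euc n → ℝ}
    (hf : ContDiffOn ℝ ∞ f e.target) :
    ContMDiffOn (𝓡 n) 𝓘(ℝ, ℝ) ∞ (fun x => f (e x)) e.source :=
  (contMDiffOn_iff_contDiffOn.mpr hf).comp (contMDiffOn_chart he) fun _ hx => e.map_source hx

theorem contMDiff_of_forall_chart {φ : M → ℝ}
    (h : ∀ e ∈ atlas (Euc n) M, ContDiffOn ℝ ∞ (fun y => φ (e.symm y)) e.target) :
    ContMDiff (𝓡 n) 𝓘(ℝ, ℝ) ∞ φ := fun x => by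
  have he := chart_mem_atlas (Euc n) x
  have h1 := contMDiffOn_comp_chart he (h _ he)
  have h2 : ContMDiffOn (𝓡 n) 𝓘(ℝ, ℝ) ∞ φ (chartAt (Euc n) x).source :=
    h1.congr fun z hz => by rw [(chartAt (Euc n) x).left_inv hz]
  exact h2.contMDiffAt ((chartAt (Euc n) x).open_source.mem_nhds (mem_chart_source _ x))

end

/-- A vector field with smooth coordinates in every chart. -/
def IsSmoothField (X : ∀ x : M, TangentSpace (𝓡 n) x) : Prop :=
  ∀ e ∈ atlas (Euc n) M, ∀ i,
    ContDiffOn ℝ ∞ (fun y => vecCoord e (e.symm y) (X (e.symm y)) i) e.target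

/-- The divergence of a vector field, computed in the chart `e` at the point of coordinates `y`. -/
def chartDiv (Ω : TupleFun n M) (e : OpenPartialHomeomorph M (Euc n))
    (X : ∀ x : M, TangentSpace (𝓡 n) x) (y : Euc n) : ℝ :=
  (coordDensity Ω e y)⁻¹ * ∑ i : Fin n, partialD i
    (fun z => coordDensity Ω e z * vecCoord e (e.symm z) (X (e.symm z)) i) y

variable {Ω : TupleFun n M} {e e' : OpenPartialHomeomorph M (Euc n)}
  {X : ∀ x : M, TangentSpace (𝓡 n) x}

theorem contDiffOn_density_mul (hΩ : IsVolumeDensity Ω) (hX : IsSmoothField X)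
    (he : e ∈ atlas (Euc n) M) (i : Fin n) : ContDiffOn ℝ ∞
      (fun z => coordDensity Ω e z * vecCoord e (e.symm z) (X (e.symm z)) i) e.target :=
  (hΩ.smooth e he).mul (hX e he i)

theorem dAt_add {φ ψ : M → ℝ} (hφ : ContMDiff (𝓡 n) 𝓘(ℝ, ℝ) ∞ φ)
    (hψ : ContMDiff (𝓡 n) 𝓘(ℝ, ℝ) ∞ ψ) (x : M) :
    dAt (n := n) (fun y => φ y + ψ y) x = dAt φ x + dAt ψ x := by
  have h := ((hφ.mdifferentiable (by simp) x).hasMFDerivAt.add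
    (hψ.mdifferentiable (by simp) x).hasMFDerivAt).mfderiv
  ext v
  exact DFunLike.congr_fun h v

theorem dAt_mul {φ ψ : M → ℝ} (hφ : ContMDiff (𝓡 n) 𝓘(ℝ, ℝ) ∞ φ)
    (hψ : ContMDiff (𝓡 n) 𝓘(ℝ, ℝ) ∞ ψ) (x : M) :
    dAt (n := n) (fun y => φ y * ψ y) x = φ x • dAt ψ x + ψ x • dAt φ x := by
  have h := ((hφ.mdifferentiable (by simp) x).hasMFDerivAt.mul
    (hψ.mdifferentiable (by simp) x).hasMFDerivAt).mfderiv
  ext v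
  exact DFunLike.congr_fun h v

theorem dAt_const (c : ℝ) (x : M) : dAt (n := n) (fun _ : M => c) x = 0 := by
  ext v
  change (mfderiv (𝓡 n) 𝓘(ℝ, ℝ) (fun _ : M => c) x : Euc n →L[ℝ] ℝ) v = 0
  rw [mfderiv_const]
  rfl

theorem dAt_const_mul (c : ℝ) {φ : M → ℝ} (hφ : ContMDiff (𝓡 n) 𝓘(ℝ, ℝ) ∞ φ) (x : M) :
    dAt (n := n) (fun y => c * φ y) x = c • dAt φ x := by
  rw [dAt_mul contMDiff_const hφ, dAt_const, smul_zero, add_zero]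

theorem dAt_eq_zero_of_notMem_tsupport {φ : M → ℝ} {x : M} (hx : x ∉ tsupport φ) :
    dAt (n := n) φ x = 0 := by
  have h : φ =ᶠ[nhds x] fun _ => 0 := notMem_tsupport_iff_eventuallyEq.mp hx
  ext v
  change (mfderiv (𝓡 n) 𝓘(ℝ, ℝ) φ x : Euc n →L[ℝ] ℝ) v = 0
  rw [h.mfderiv_eq, mfderiv_const]
  rfl

variable [IsManifold (𝓡 n) ∞ M]

theorem contDiffOn_chartDiv (hΩ : IsVolumeDensity Ω) (hX : IsSmoothField X)
    (he : e ∈ atlas (Euc n) M) : ContDiffOn ℝ ∞ (chartDiv Ω e X) e.target :=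
  ((hΩ.smooth e he).inv fun _ hy => (coordDensity_pos hΩ he hy).ne').mul
    (ContDiffOn.sum fun i _ =>
      contDiffOn_partialD e.open_target (contDiffOn_density_mul hΩ hX he i) i)

theorem continuousOn_chartDiv (hΩ : IsVolumeDensity Ω) (hX : IsSmoothField X)
    (he : e ∈ atlas (Euc n) M) : ContinuousOn (fun x => chartDiv Ω e X (e x)) e.source :=
  (contMDiffOn_comp_chart he (contDiffOn_chartDiv hΩ hX he)).continuousOn

theorem contMDiff_dAt_apply (hX : IsSmoothField X) {φ : M → ℝ}
    (hφ : ContMDiff (𝓡 n) 𝓘(ℝ, ℝ) ∞ φ) :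
    ContMDiff (𝓡 n) 𝓘(ℝ, ℝ) ∞ fun x => dAt φ x (X x) := by
  refine contMDiff_of_forall_chart fun e he => ?_
  refine ContDiffOn.congr (f := fun y => ∑ i, vecCoord e (e.symm y) (X (e.symm y)) i *
    partialD i (fun z => φ (e.symm z)) y) ?_ fun y hy =>
      dAt_eq_sum he hy ((hφ.mdifferentiable (by simp)) _) _
  exact ContDiffOn.sum fun i _ => (hX e he i).mul
    (contDiffOn_partialD e.open_target (contDiffOn_comp_chart_symm he hφ) i)

/-! ### The divergence theorem on a closed manifold -/

variable [MeasurableSpace M] [BorelSpace M] [CompactSpace M] [T2Space M]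

omit [T2Space M] in
/-- Integration by parts for a function supported in the domain of a chart. -/
theorem integral_mul_chartDiv (hΩ : IsVolumeDensity Ω) (hX : IsSmoothField X)
    (he : e ∈ atlas (Euc n) M) {ψ : M → ℝ} (hψ : ContMDiff (𝓡 n) 𝓘(ℝ, ℝ) ∞ ψ)
    (hψe : tsupport ψ ⊆ e.source) :
    ∫ x, ψ x * chartDiv Ω e X (e x) ∂(volMeasure Ω) =
      -∫ x, dAt ψ x (X x) ∂(volMeasure Ω) := by
  rw [integral_volMeasure_of_support hΩ he (continuous_mul_of_tsupport_subset e.open_source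
      hψ.continuous hψe (continuousOn_chartDiv hΩ hX he)) fun x hx => by
        rw [image_eq_zero_of_notMem_tsupport fun h => hx (hψe h), zero_mul],
    integral_volMeasure_of_support hΩ he (contMDiff_dAt_apply hX hψ).continuous fun x hx => by
        rw [dAt_eq_zero_of_notMem_tsupport fun h => hx (hψe h)]; rfl]
  -- The coordinate expression of `ψ`, extended by zero. As `M` is compact, the image of `tsupport
  -- ψ` is compact and so closed in `ℝⁿ`; hence the extension stays smooth.
  set Ψ : Euc n → ℝ := e.target.indicator fun y => ψ (e.symm y) with hΨdef
  have hΨeq : Set.EqOn Ψ (fun y => ψ (e.symm y)) e.target := fun y hy =>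
    Set.indicator_of_mem hy _
  have hK : IsCompact (e '' tsupport ψ) :=
    (isClosed_tsupport ψ).isCompact.image_of_continuousOn (e.continuousOn.mono hψe)
  have hsupp : tsupport Ψ ⊆ e '' tsupport ψ := by
    refine closure_minimal (fun y hy => ?_) hK.isClosed
    have hyt : y ∈ e.target := by
      by_contra h
      exact hy (Set.indicator_of_notMem h _)
    refine ⟨e.symm y, subset_tsupport _ ?_, e.right_inv hyt⟩
    rw [Function.mem_support] at hy ⊢
    rwa [hΨeq hyt] at hy
  have hΨU : tsupport Ψ ⊆ e.target := hsupp.trans fun y ⟨x, hx, hxy⟩ =>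
    hxy ▸ e.map_source (hψe hx)
  have hcs : HasCompactSupport Ψ := hK.of_isClosed_subset (isClosed_tsupport _) hsupp
  have hΨt : ContDiffOn ℝ ∞ Ψ e.target := (contDiffOn_comp_chart_symm he hψ).congr hΨeq
  have hΨ : ContDiff ℝ ∞ Ψ := by
    refine contDiff_iff_contDiffAt.mpr fun y => ?_
    by_cases hy : y ∈ tsupport Ψ
    · exact hΨt.contDiffAt (e.open_target.mem_nhds (hΨU hy))
    · exact contDiffAt_const.congr_of_eventuallyEq (notMem_tsupport_iff_eventuallyEq.mp hy)
  have hd : ∀ i, ∀ y ∈ e.target,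
      partialD i (fun z => ψ (e.symm z)) y = partialD i Ψ y := fun i y hy =>
    (partialD_congr e.open_target hΨeq hy i).symm
  have hint : ∀ (i : Fin n) {F G : Euc n → ℝ}, Continuous F → HasCompactSupport F →
      tsupport F ⊆ e.target → ContinuousOn G e.target →
      IntegrableOn (fun y => F y * G y) e.target := fun i F G hF hFc hFt hG =>
    ((continuous_mul_of_tsupport_subset e.open_target hF hFt
      hG).integrable_of_hasCompactSupport hFc.mul_right).integrableOn
  -- The factor `ρ⁻¹` in the divergence cancels the density `ρ` of the measure.
  calc _ = ∫ y in e.target, ∑ i, Ψ y * partialD i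
        (fun z => coordDensity Ω e z * vecCoord e (e.symm z) (X (e.symm z)) i) y := by
        refine setIntegral_congr_fun e.open_target.measurableSet fun y hy => ?_
        have := (coordDensity_pos hΩ he hy).ne'
        simp only [chartDiv, e.right_inv hy, hΨeq hy, ← Finset.mul_sum]
        field_simp
    _ = -∫ y in e.target, ∑ i, partialD i Ψ y *
        (coordDensity Ω e y * vecCoord e (e.symm y) (X (e.symm y)) i) := by
        rw [integral_finsetSum, integral_finsetSum, ← Finset.sum_neg_distrib]
        · exact Finset.sum_congr rfl fun i _ => setIntegral_mul_partialD e.open_target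
            (contDiffOn_density_mul hΩ hX he i) hΨ hcs hΨU i
        · exact fun i _ => hint i ((hΨ.continuous_fderiv (by simp)).clm_apply continuous_const)
            (hcs.fderiv_apply ℝ _) ((tsupport_fderiv_apply_subset ℝ _).trans hΨU)
            (contDiffOn_density_mul hΩ hX he i).continuousOn
        · exact fun i _ => hint i hΨ.continuous hcs hΨU
            (contDiffOn_partialD e.open_target (contDiffOn_density_mul hΩ hX he i) i).continuousOn
    _ = _ := by
        congr 1
        refine setIntegral_congr_fun e.open_target.measurableSet fun y hy => ?_
        simp only [dAt_eq_sum he hy ((hψ.mdifferentiable (by simp)) _), hd _ y hy, Finset.mul_sum]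
        exact Finset.sum_congr rfl fun i _ => by ring

omit [T2Space M] in
theorem integrable_of_continuous (hΩ : IsVolumeDensity Ω) {f : M → ℝ} (hf : Continuous f) :
    Integrable f (volMeasure Ω) :=
  haveI := isFiniteMeasure_volMeasure hΩ
  hf.integrable_of_hasCompactSupport (HasCompactSupport.of_compactSpace f)

/-- The divergence does not depend on the chart. -/
theorem chartDiv_congr (hΩ : IsVolumeDensity Ω) (hX : IsSmoothField X)
    (he : e ∈ atlas (Euc n) M) (he' : e' ∈ atlas (Euc n) M) {x : M}
    (hx : x ∈ e.source) (hx' : x ∈ e'.source) :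
    chartDiv Ω e X (e x) = chartDiv Ω e' X (e' x) := by
  have hU : IsOpen (e.source ∩ e'.source) := e.open_source.inter e'.open_source
  have hc := (continuousOn_chartDiv hΩ hX he).mono (Set.inter_subset_left (t := e'.source))
  have hc' := (continuousOn_chartDiv hΩ hX he').mono (Set.inter_subset_right (s := e.source))
  have := isFiniteMeasure_volMeasure hΩ
  have := isOpenPosMeasure_volMeasure hΩ
  -- Tested against any smooth `ψ` supported in the overlap, both expressions give `-∫ dψ(X)`. They
  -- agree almost everywhere, hence everywhere by continuity, as nonempty open sets have positive
  -- measure.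
  have h := IsOpen.ae_eq_zero_of_integral_contMDiff_smul_eq_zero (𝓡 n) (μ := volMeasure Ω) hU
    (f := fun x => chartDiv Ω e X (e x) - chartDiv Ω e' X (e' x))
    ((hc.sub hc').locallyIntegrableOn hU.measurableSet) fun ψ hψ _ hψU => by
      simp only [smul_eq_mul, mul_sub]
      rw [integral_sub
        (integrable_of_continuous hΩ (continuous_mul_of_tsupport_subset hU hψ.continuous hψU hc))
        (integrable_of_continuous hΩ (continuous_mul_of_tsupport_subset hU hψ.continuous hψU hc')),
        integral_mul_chartDiv hΩ hX he hψ (hψU.trans Set.inter_subset_left),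
        integral_mul_chartDiv hΩ hX he' hψ (hψU.trans Set.inter_subset_right), sub_self]
  refine Measure.eqOn_open_of_ae_eq (μ := volMeasure Ω)
    (f := fun x => chartDiv Ω e X (e x)) (g := fun x => chartDiv Ω e' X (e' x))
    ?_ hU hc hc' ⟨hx, hx'⟩
  refine (ae_restrict_iff' hU.measurableSet).mpr (h.mono fun z hz hzU => ?_)
  exact sub_eq_zero.mp (hz hzU)

theorem divergence_eq_chartDiv (hΩ : IsVolumeDensity Ω) (hX : IsSmoothField X)
    (he : e ∈ atlas (Euc n) M) {x : M} (hx : x ∈ e.source) :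
    divergence Ω X x = chartDiv Ω e X (e x) :=
  chartDiv_congr hΩ hX (chart_mem_atlas _ x) he (mem_chart_source _ x) hx

theorem contMDiff_divergence (hΩ : IsVolumeDensity Ω) (hX : IsSmoothField X) :
    ContMDiff (𝓡 n) 𝓘(ℝ, ℝ) ∞ (divergence Ω X) := by
  refine contMDiff_of_forall_chart fun e he => ?_
  refine (contDiffOn_chartDiv hΩ hX he).congr fun y hy => ?_
  rw [divergence_eq_chartDiv hΩ hX he (e.map_target hy), e.right_inv hy]

/-- The divergence theorem on a closed manifold. -/
theorem integral_mul_divergence (hΩ : IsVolumeDensity Ω) (hX : IsSmoothField X) {ψ : M → ℝ}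
    (hψ : ContMDiff (𝓡 n) 𝓘(ℝ, ℝ) ∞ ψ) :
    ∫ x, ψ x * divergence Ω X x ∂(volMeasure Ω) = -∫ x, dAt ψ x (X x) ∂(volMeasure Ω) := by
  have hdiv := (contMDiff_divergence hΩ hX).continuous
  obtain ⟨t, ht⟩ := isCompact_univ.elim_finite_subcover
    (fun x : M => (chartAt (Euc n) x).source) (fun x => (chartAt (Euc n) x).open_source)
    fun x _ => Set.mem_iUnion.mpr ⟨x, mem_chart_source _ x⟩
  obtain ⟨p, hp⟩ := SmoothPartitionOfUnity.exists_isSubordinate (𝓡 n) isClosed_univ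
    (fun x : t => (chartAt (Euc n) (x : M)).source) (fun x => (chartAt (Euc n) (x : M)).open_source)
    (by rwa [Set.iUnion_subtype])
  have hi : ∀ φ : C^∞⟮𝓡 n, M; ℝ⟯,
      Integrable (fun x => φ x * divergence Ω X x + dAt φ x (X x)) (volMeasure Ω) := fun φ =>
    integrable_of_continuous hΩ ((φ.contMDiff.continuous.mul hdiv).add
      (contMDiff_dAt_apply hX φ.contMDiff).continuous)
  -- The defect of the divergence theorem. It is linear in the test function, so it need only vanish
  -- on each `p i * ψ'`, which is supported in one chart.
  let L : C^∞⟮𝓡 n, M; ℝ⟯ →ₗ[ℝ] ℝ :=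
    { toFun := fun φ => ∫ x, (φ x * divergence Ω X x + dAt φ x (X x)) ∂(volMeasure Ω)
      map_add' := fun φ φ' => by
        rw [← integral_add]
        · refine integral_congr_ae (Filter.Eventually.of_forall fun x => ?_)
          have h : dAt (⇑(φ + φ')) x = dAt φ x + dAt φ' x := dAt_add φ.contMDiff φ'.contMDiff x
          simp only [h]
          simp only [ContMDiffMap.coe_add, Pi.add_apply, LinearMap.add_apply]
          ring
        · exact hi φ
        · exact hi φ'
      map_smul' := fun c φ => by
        rw [RingHom.id_apply, smul_eq_mul, ← integral_const_mul]
        refine integral_congr_ae (Filter.Eventually.of_forall fun x => ?_)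
        have h : dAt (⇑(c • φ)) x = c • dAt φ x := dAt_const_mul c φ.contMDiff x
        simp only [h]
        simp only [ContMDiffMap.coe_smul, Pi.smul_apply, LinearMap.smul_apply, smul_eq_mul]
        ring }
  have hL : ∀ φ : C^∞⟮𝓡 n, M; ℝ⟯, L φ = ∫ x, φ x * divergence Ω X x ∂(volMeasure Ω) +
      ∫ x, dAt φ x (X x) ∂(volMeasure Ω) := fun φ =>
    integral_add (integrable_of_continuous hΩ (φ.contMDiff.continuous.mul hdiv))
      (integrable_of_continuous hΩ (contMDiff_dAt_apply hX φ.contMDiff).continuous)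
  let ψ' : C^∞⟮𝓡 n, M; ℝ⟯ := ⟨ψ, hψ⟩
  have hsum : ψ' = ∑ i, p i * ψ' := by
    ext x
    have h1 := p.sum_eq_one (Set.mem_univ x)
    rw [finsum_eq_sum_of_fintype] at h1
    rw [← Finset.sum_mul, ContMDiffMap.coe_mul, Pi.mul_apply]
    have h2 : (∑ i, p i : C^∞⟮𝓡 n, M; ℝ⟯) x = 1 := by
      rw [← h1]
      exact map_sum (ContMDiffMap.evalRingHom x) _ _
    rw [h2, one_mul]
  have hzero : L ψ' = 0 := by
    rw [hsum, map_sum]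
    refine Finset.sum_eq_zero fun i _ => ?_
    have hs : tsupport (⇑(p i * ψ')) ⊆ (chartAt (Euc n) (i : M)).source :=
      (tsupport_mul_subset_left (f := p i) (g := ψ')).trans (hp i)
    rw [hL, ← eq_neg_iff_add_eq_zero,
      ← integral_mul_chartDiv hΩ hX (chart_mem_atlas _ (i : M)) (p i * ψ').contMDiff hs]
    refine integral_congr_ae (Filter.Eventually.of_forall fun x => ?_)
    by_cases hx : x ∈ (chartAt (Euc n) (i : M)).source
    · simp only [divergence_eq_chartDiv hΩ hX (chart_mem_atlas _ (i : M)) hx]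
    · simp only [image_eq_zero_of_notMem_tsupport fun h => hx (hs h), zero_mul]
  rw [hL] at hzero
  exact eq_neg_of_add_eq_zero_left hzero

end

section

variable {n : ℕ} {M : Type*} [TopologicalSpace M] [ChartedSpace (Euc n) M]

/-! ### Calculus of the divergence -/

section

variable [IsManifold (𝓡 n) ∞ M] {Ω Ω' : TupleFun n M} {e : OpenPartialHomeomorph M (Euc n)}
  {X Y : ∀ x : M, TangentSpace (𝓡 n) x}

omit [IsManifold (𝓡 n) ∞ M] in
theorem vecCoord_add (e : OpenPartialHomeomorph M (Euc n)) (x : M) (v w : TangentSpace (𝓡 n) x)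
    (i : Fin n) : vecCoord e x (v + w) i = vecCoord e x v i + vecCoord e x w i := by
  rw [vecCoord, map_add]; rfl

omit [IsManifold (𝓡 n) ∞ M] in
theorem vecCoord_smul (e : OpenPartialHomeomorph M (Euc n)) (x : M) (c : ℝ)
    (v : TangentSpace (𝓡 n) x) (i : Fin n) : vecCoord e x (c • v) i = c * vecCoord e x v i := by
  rw [vecCoord, map_smul]; rfl

omit [IsManifold (𝓡 n) ∞ M] in
theorem IsSmoothField.add (hX : IsSmoothField X) (hY : IsSmoothField Y) :
    IsSmoothField fun x => X x + Y x := fun e he i => by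
  simp only [vecCoord_add]
  exact (hX e he i).add (hY e he i)

theorem IsSmoothField.smul (hX : IsSmoothField X) {f : M → ℝ}
    (hf : ContMDiff (𝓡 n) 𝓘(ℝ, ℝ) ∞ f) : IsSmoothField fun x => f x • X x := fun e he i => by
  simp only [vecCoord_smul]
  exact (contDiffOn_comp_chart_symm he hf).mul (hX e he i)

omit [IsManifold (𝓡 n) ∞ M] in
theorem differentiableAt_density_mul (hΩ : IsVolumeDensity Ω) (hX : IsSmoothField X)
    (he : e ∈ atlas (Euc n) M) {y : Euc n} (hy : y ∈ e.target) (i : Fin n) : DifferentiableAt ℝ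
      (fun z => coordDensity Ω e z * vecCoord e (e.symm z) (X (e.symm z)) i) y :=
  ((contDiffOn_density_mul hΩ hX he i).contDiffAt (e.open_target.mem_nhds hy)).differentiableAt
    (by simp)

omit [IsManifold (𝓡 n) ∞ M] in
theorem divergence_add (hΩ : IsVolumeDensity Ω) (hX : IsSmoothField X) (hY : IsSmoothField Y)
    (x : M) : divergence Ω (fun x => X x + Y x) x = divergence Ω X x + divergence Ω Y x := by
  have hy := (chartAt (Euc n) x).map_source (mem_chart_source _ x)
  have he := chart_mem_atlas (Euc n) x
  simp only [divergence]
  rw [← mul_add, ← Finset.sum_add_distrib]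
  congr 1
  refine Finset.sum_congr rfl fun i _ => ?_
  simp only [vecCoord_add, mul_add]
  rw [partialD, fderiv_fun_add (differentiableAt_density_mul hΩ hX he hy i)
    (differentiableAt_density_mul hΩ hY he hy i)]
  rfl

theorem divergence_smul (hΩ : IsVolumeDensity Ω) (hX : IsSmoothField X) {f : M → ℝ}
    (hf : ContMDiff (𝓡 n) 𝓘(ℝ, ℝ) ∞ f) (x : M) :
    divergence Ω (fun x => f x • X x) x = f x * divergence Ω X x + dAt f x (X x) := by
  -- Writing the point as `e.symm y` with `y` free allows `subst`, which removes the mismatch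
  -- between the tangent spaces at `x` and at `e.symm (e x)`.
  obtain ⟨e, he, y, hy, hxy, hchart⟩ : ∃ e ∈ atlas (Euc n) M, ∃ y ∈ e.target, e.symm y = x ∧
      ∀ Z : ∀ x : M, TangentSpace (𝓡 n) x, divergence Ω Z x = chartDiv Ω e Z y :=
    ⟨chartAt (Euc n) x, chart_mem_atlas _ x, _, (chartAt (Euc n) x).map_source
      (mem_chart_source _ x), (chartAt (Euc n) x).left_inv (mem_chart_source _ x), fun _ => rfl⟩
  rw [hchart, hchart]
  subst hxy
  have hpos := (coordDensity_pos hΩ he hy).ne'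
  rw [dAt_eq_sum he hy (hf.mdifferentiable (by simp) _)]
  have key : ∀ i, partialD i (fun z => coordDensity Ω e z *
      vecCoord e (e.symm z) (f (e.symm z) • X (e.symm z)) i) y =
      f (e.symm y) * partialD i (fun z => coordDensity Ω e z *
        vecCoord e (e.symm z) (X (e.symm z)) i) y +
      coordDensity Ω e y * (vecCoord e (e.symm y) (X (e.symm y)) i *
        partialD i (fun z => f (e.symm z)) y) := fun i => by
    rw [← mul_assoc, ← partialD_mul (f := fun z => f (e.symm z))
      (hasFDerivAt_comp_chart_symm he hy (hf.mdifferentiable (by simp) _)).differentiableAt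
      (differentiableAt_density_mul hΩ hX he hy i)]
    congr 1
    ext z
    rw [vecCoord_smul]
    ring
  simp only [chartDiv, key, Finset.sum_add_distrib, ← Finset.mul_sum]
  field_simp

/-- In coordinates `(fρ)⁻¹ ∂ᵢ(fρ Xⁱ)` is `f⁻¹` times the old divergence of `f X`, to which the
Leibniz rule applies. This is the source of the drift term. -/
theorem divergence_mul_density (hΩ : IsVolumeDensity Ω) (hX : IsSmoothField X) {f : M → ℝ}
    (hf : ContMDiff (𝓡 n) 𝓘(ℝ, ℝ) ∞ f) (h0 : ∀ x, f x ≠ 0)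
    (h : ∀ x v, Ω' x v = f x * Ω x v) (x : M) :
    divergence Ω' X x = divergence Ω X x + (f x)⁻¹ * dAt f x (X x) := by
  have h1 : divergence Ω' X x = (f x)⁻¹ * divergence Ω (fun x => f x • X x) x := by
    have hx : (chartAt (Euc n) x).symm (chartAt (Euc n) x x) = x :=
      (chartAt (Euc n) x).left_inv (mem_chart_source _ x)
    simp only [divergence, coordDensity, h, vecCoord_smul]
    rw [hx, mul_inv, mul_assoc]
    simp only [mul_assoc, mul_left_comm (f _)]
  rw [h1, divergence_smul hΩ hX hf, mul_add, ← mul_assoc, inv_mul_cancel₀ (h0 x), one_mul]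

end

/-! ### The metric in coordinates -/

section

variable [IsManifold (𝓡 n) ∞ M] {e : OpenPartialHomeomorph M (Euc n)}

/-- The coordinate field is the tangent map of the inverse chart applied to a constant section. -/
theorem contMDiffOn_coordVec (he : e ∈ atlas (Euc n) M) (i : Fin n) :
    ContMDiffOn (𝓡 n) (𝓡 n).tangent ∞
      (fun y => (⟨e.symm y, coordVec e y i⟩ : TangentBundle (𝓡 n) M)) e.target := by
  have : IsManifold (𝓡 n) 1 M := IsManifold.of_le (n := ∞) (by simp)
  have h1 := (contMDiffOn_chart_symm he).contMDiffOn_tangentMapWithin (m := ∞) (by simp)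
    e.open_target.uniqueMDiffOn
  have h2 : ContMDiffOn (𝓡 n) (𝓡 n).tangent ∞
      (fun y : Euc n => (⟨y, (EuclideanSpace.single i 1 : Euc n)⟩ :
        TangentBundle (𝓡 n) (Euc n))) e.target :=
    contMDiffOn_vectorSpace_iff_contDiffOn.mpr contDiffOn_const
  refine (h1.comp h2 fun y hy => hy).congr fun y hy => ?_
  simp only [Function.comp, tangentMapWithin, mfderivWithin_of_isOpen e.open_target hy]
  rfl

/-- The Gram matrix of a tuple of tangent vectors. -/
def gram (g : Metric n M) (x : M) (v : Fin n → TangentSpace (𝓡 n) x) :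
    Matrix (Fin n) (Fin n) ℝ :=
  Matrix.of fun i j => g.inner x (v i) (v j)

theorem contDiffOn_gram (g : Metric n M) (he : e ∈ atlas (Euc n) M) (i j : Fin n) :
    ContDiffOn ℝ ∞ (fun y => gram g (e.symm y) (coordVec e y) i j) e.target := by
  intro y hy
  refine contMDiffWithinAt_iff_contDiffWithinAt.mp ?_
  have h : ContMDiffWithinAt (𝓡 n) ((𝓡 n).prod 𝓘(ℝ)) ∞
      (fun y => Bundle.TotalSpace.mk' ℝ (E := Bundle.Trivial M ℝ) (e.symm y)
        (g.inner (e.symm y) (coordVec e y i) (coordVec e y j))) e.target y := by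
    apply ContMDiffWithinAt.clm_bundle_apply₂ (F₁ := Euc n) (F₂ := Euc n)
    · exact ContMDiffAt.comp_contMDiffWithinAt y g.contMDiff.contMDiffAt
        (contMDiffOn_chart_symm he y hy)
    · exact contMDiffOn_coordVec he i y hy
    · exact contMDiffOn_coordVec he j y hy
  simp only [Bundle.contMDiffWithinAt_totalSpace] at h
  exact h.2

theorem inner_sum_sum (g : Metric n M) (x : M) (v : Fin n → TangentSpace (𝓡 n) x)
    (c d : Fin n → ℝ) : g.inner x (∑ i, c i • v i) (∑ j, d j • v j) =
      ∑ i, ∑ j, c i * gram g x v i j * d j := by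
  rw [map_sum]
  conv_rhs => rw [Finset.sum_comm]
  refine Finset.sum_congr rfl fun j _ => ?_
  rw [map_smul, g.symm, map_sum, smul_eq_mul, Finset.mul_sum]
  refine Finset.sum_congr rfl fun i _ => ?_
  rw [map_smul, g.symm, smul_eq_mul]
  simp only [gram, Matrix.of_apply]
  ring

theorem posDef_gram (g : Metric n M) {x : M} {v : Fin n → TangentSpace (𝓡 n) x}
    (hv : LinearIndependent ℝ v) : (gram g x v).PosDef := by
  refine Matrix.PosDef.of_dotProduct_mulVec_pos ?_ fun c hc => ?_
  · ext i j
    simp [gram, g.symm x (v i) (v j)]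
  · have h0 : ∑ i, c i • v i ≠ 0 := fun h => hc (by
      ext i
      exact Fintype.linearIndependent_iff.mp hv c h i)
    have h1 := g.pos x _ h0
    rw [inner_sum_sum] at h1
    simpa [dotProduct, Matrix.mulVec, Finset.mul_sum, mul_assoc] using h1

theorem isUnit_det_gram (g : Metric n M) (he : e ∈ atlas (Euc n) M) {y : Euc n}
    (hy : y ∈ e.target) : IsUnit (gram g (e.symm y) (coordVec e y)).det :=
  (posDef_gram g (linearIndependent_coordVec he hy)).det_pos.ne'.isUnit

theorem contDiffOn_det {U : Set (Euc n)} {A : Euc n → Matrix (Fin n) (Fin n) ℝ}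
    (hA : ∀ i j, ContDiffOn ℝ ∞ (fun y => A y i j) U) :
    ContDiffOn ℝ ∞ (fun y => (A y).det) U := by
  simp only [Matrix.det_apply']
  exact ContDiffOn.sum fun σ _ => contDiffOn_const.mul (contDiffOn_prod fun i _ => hA _ _)

/-- Cramer's rule: an entry of the inverse is a quotient of determinants, the numerator being that
of the Gram matrix with row `j` replaced by a constant one. -/
theorem contDiffOn_gram_inv (g : Metric n M) (he : e ∈ atlas (Euc n) M) (i j : Fin n) :
    ContDiffOn ℝ ∞ (fun y => (gram g (e.symm y) (coordVec e y))⁻¹ i j) e.target := by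
  simp only [Matrix.inv_def, Ring.inverse_eq_inv', Matrix.smul_apply, smul_eq_mul,
    Matrix.adjugate_apply]
  refine ((contDiffOn_det (contDiffOn_gram g he)).inv fun y hy =>
    (isUnit_det_gram g he hy).ne_zero).mul (contDiffOn_det fun k l => ?_)
  by_cases hk : k = j
  · subst hk
    simp only [Matrix.updateRow_self]
    exact contDiffOn_const
  · simp only [Matrix.updateRow_ne hk]
    exact contDiffOn_gram g he k l

/-- The Riemannian volume density is a volume density. -/
theorem isVolumeDensity_riemDensity (g : Metric n M) : IsVolumeDensity (riemDensity g) where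
  map_det x A v := by
    let b : Module.Basis (Fin n) ℝ (TangentSpace (𝓡 n) x) :=
      (EuclideanSpace.basisFun (Fin n) ℝ).toBasis
    -- Gram determinants scale by the square of the determinant in a fixed basis; the square root
    -- turns this into an absolute value.
    have key : ∀ w : Fin n → TangentSpace (𝓡 n) x,
        (gram g x w).det = b.det w ^ 2 * (gram g x b).det := fun w => by
      have hw : gram g x w = (b.toMatrix w).transpose * gram g x b * b.toMatrix w := by
        ext i j
        have h := inner_sum_sum g x b (b.repr (w i)) (b.repr (w j))
        rw [b.sum_repr, b.sum_repr] at h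
        rw [gram, Matrix.of_apply, h, Matrix.mul_apply, Finset.sum_comm]
        refine Finset.sum_congr rfl fun k _ => ?_
        rw [Matrix.mul_apply, Finset.sum_mul]
        rfl
      rw [hw, Matrix.det_mul, Matrix.det_mul, Matrix.det_transpose, Module.Basis.det_apply]
      ring
    change √(gram g x (fun i => A (v i))).det = |LinearMap.det A| * √(gram g x v).det
    rw [key, key v, show (fun i => A (v i)) = A ∘ v from rfl, b.det_comp, mul_pow, mul_assoc,
      Real.sqrt_mul (sq_nonneg _), Real.sqrt_sq_eq_abs]
  pos x v hv := Real.sqrt_pos.mpr (posDef_gram g hv).det_pos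
  smooth e he := (contDiffOn_det (contDiffOn_gram g he)).sqrt fun y hy =>
    (isUnit_det_gram g he hy).ne_zero

theorem flat_apply (g : Metric n M) (x : M) (v w : TangentSpace (𝓡 n) x) :
    flat g x v w = g.inner x v w := rfl

theorem inner_grad (g : Metric n M) (φ : M → ℝ) (x : M) (v : TangentSpace (𝓡 n) x) :
    g.inner x (grad g φ x) v = dAt φ x v := by
  rw [← flat_apply, grad, LinearEquiv.apply_symm_apply]

/-- The coordinates of a gradient. -/
theorem vecCoord_grad (g : Metric n M) (he : e ∈ atlas (Euc n) M) {y : Euc n}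
    (hy : y ∈ e.target) {φ : M → ℝ} (hφ : ContMDiff (𝓡 n) 𝓘(ℝ, ℝ) ∞ φ) (i : Fin n) :
    vecCoord e (e.symm y) (grad g φ (e.symm y)) i =
      ∑ j, (gram g (e.symm y) (coordVec e y))⁻¹ i j * partialD j (fun z => φ (e.symm z)) y := by
  set G := gram g (e.symm y) (coordVec e y) with hG
  -- The identities `g(∇φ, ∂ⱼ) = ∂ⱼφ` form a linear system with matrix `G`, which is then inverted.
  have h : G.mulVec (vecCoord e (e.symm y) (grad g φ (e.symm y))) =
      fun j => partialD j (fun z => φ (e.symm z)) y := by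
    ext j
    rw [partialD_comp_chart_symm he hy (hφ.mdifferentiable (by simp) _), ← inner_grad g, g.symm]
    conv_rhs => rw [eq_sum_coordVec he hy (grad g φ (e.symm y)), map_sum]
    rw [Matrix.mulVec, dotProduct]
    refine Finset.sum_congr rfl fun k _ => ?_
    rw [map_smul, smul_eq_mul, mul_comm]
    rfl
  have h2 : G⁻¹.mulVec (G.mulVec (vecCoord e (e.symm y) (grad g φ (e.symm y)))) =
      vecCoord e (e.symm y) (grad g φ (e.symm y)) := by
    rw [Matrix.mulVec_mulVec, Matrix.nonsing_inv_mul _ (isUnit_det_gram g he hy),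
      Matrix.one_mulVec]
  rw [← h2, h]
  rfl

theorem isSmoothField_grad (g : Metric n M) {φ : M → ℝ} (hφ : ContMDiff (𝓡 n) 𝓘(ℝ, ℝ) ∞ φ) :
    IsSmoothField (grad g φ) := by
  intro e he i
  refine ContDiffOn.congr ?_ fun y hy => vecCoord_grad g he hy hφ i
  exact ContDiffOn.sum fun j _ => (contDiffOn_gram_inv g he i j).mul
    (contDiffOn_partialD e.open_target (contDiffOn_comp_chart_symm he hφ) j)

end

end

section

/-! ### Multiplication operators between weighted `L²` spaces -/

section

variable {α : Type*} [MeasurableSpace α] {μ ν : Measure α} {a : α → ℝ}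

theorem absolutelyContinuous_withDensity_sq (ha : Measurable a) (h0 : ∀ x, a x ≠ 0)
    (hν : ν = μ.withDensity fun x => ENNReal.ofReal (a x ^ 2)) : μ ≪ ν := by
  rw [hν]
  refine withDensity_absolutelyContinuous' (ha.pow_const 2).ennreal_ofReal.aemeasurable
    (Filter.Eventually.of_forall fun x => ?_)
  rw [Ne, ENNReal.ofReal_eq_zero, not_le]
  exact sq_pos_of_ne_zero (h0 x)

/-- Pointwise `|a f|² = a² |f|²`. Since `a²` is measurable and finite, `f` itself may be any
function. -/
theorem eLpNorm_withDensity_sq (ha : Measurable a)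
    (hν : ν = μ.withDensity fun x => ENNReal.ofReal (a x ^ 2)) (f : α → ℂ) :
    eLpNorm (fun x => (a x : ℂ) * f x) 2 μ = eLpNorm f 2 ν := by
  rw [eLpNorm_eq_lintegral_rpow_enorm_toReal (by simp) (by simp),
    eLpNorm_eq_lintegral_rpow_enorm_toReal (by simp) (by simp), hν,
    lintegral_withDensity_eq_lintegral_mul_non_measurable μ (ha.pow_const 2).ennreal_ofReal
      (Filter.Eventually.of_forall fun _ => ENNReal.ofReal_lt_top)]
  congr 1
  refine lintegral_congr fun x => ?_
  have h : ENNReal.ofReal (a x ^ 2) = ‖(a x : ℂ)‖ₑ ^ 2 := by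
    rw [← ofReal_norm, Complex.norm_real, ← ENNReal.ofReal_pow (norm_nonneg _),
      Real.norm_eq_abs, sq_abs]
  simp only [Pi.mul_apply, h, enorm_mul, ENNReal.toReal_ofNat, ENNReal.rpow_ofNat, mul_pow]

theorem memLp_mul_withDensity_sq (ha : Measurable a) (h0 : ∀ x, a x ≠ 0)
    (hν : ν = μ.withDensity fun x => ENNReal.ofReal (a x ^ 2)) {f : α → ℂ} (hf : MemLp f 2 ν) :
    MemLp (fun x => (a x : ℂ) * f x) 2 μ :=
  ⟨(Complex.measurable_ofReal.comp ha).aestronglyMeasurable.mul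
    (hf.1.mono_ac (absolutelyContinuous_withDensity_sq ha h0 hν)), by
    rw [eLpNorm_withDensity_sq ha hν]; exact hf.2⟩

theorem exists_mul_linearIsometryEquiv (ha : Measurable a) (h0 : ∀ x, a x ≠ 0)
    (hν : ν = μ.withDensity fun x => ENNReal.ofReal (a x ^ 2)) :
    ∃ U : Lp ℂ 2 ν ≃ₗᵢ[ℂ] Lp ℂ 2 μ, ∀ f, U f =ᵐ[μ] fun x => (a x : ℂ) * f x := by
  have hμν := absolutelyContinuous_withDensity_sq ha h0 hν
  have hνμ : ν ≪ μ := hν ▸ withDensity_absolutelyContinuous _ _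
  have hm : ∀ f : Lp ℂ 2 ν, MemLp (fun x => (a x : ℂ) * f x) 2 μ := fun f =>
    memLp_mul_withDensity_sq ha h0 hν (Lp.memLp f)
  let T : Lp ℂ 2 ν →ₗᵢ[ℂ] Lp ℂ 2 μ :=
    { toFun := fun f => (hm f).toLp
      map_add' := fun f f' => by
        rw [← MemLp.toLp_add, MemLp.toLp_eq_toLp_iff]
        filter_upwards [hμν.ae_eq (Lp.coeFn_add f f')] with x hx
        rw [hx, Pi.add_apply, Pi.add_apply, mul_add]
      map_smul' := fun c f => by
        rw [RingHom.id_apply, ← MemLp.toLp_const_smul, MemLp.toLp_eq_toLp_iff]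
        filter_upwards [hμν.ae_eq (Lp.coeFn_smul c f)] with x hx
        rw [hx, Pi.smul_apply, Pi.smul_apply, smul_eq_mul, smul_eq_mul, mul_left_comm]
      norm_map' := fun f => by
        change ‖(hm f).toLp‖ = _
        rw [Lp.norm_toLp, eLpNorm_withDensity_sq ha hν, Lp.norm_def] }
  have hT : ∀ f, T f =ᵐ[μ] fun x => (a x : ℂ) * f x := fun f => (hm f).coeFn_toLp
  -- The preimage of `h` is `a⁻¹ h`; it lies in `L²(ν)` by the norm identity, because `a (a⁻¹ h) =
  -- h`.
  have hsurj : Function.Surjective T := fun h => by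
    have hmul : ∀ x, (a x : ℂ) * (((a x)⁻¹ : ℝ) * h x) = h x := fun x => by
      have : (a x : ℂ) ≠ 0 := Complex.ofReal_ne_zero.mpr (h0 x)
      push_cast
      field_simp
    have hh : MemLp (fun x => (((a x)⁻¹ : ℝ) : ℂ) * h x) 2 ν :=
      ⟨((Complex.measurable_ofReal.comp ha.inv).aestronglyMeasurable.mul
        (Lp.memLp h).1).mono_ac hνμ, by
        rw [← eLpNorm_withDensity_sq ha hν]
        simp only [hmul]
        exact (Lp.memLp h).2⟩
    refine ⟨hh.toLp, Lp.ext ((hT _).trans ?_)⟩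
    filter_upwards [hμν.ae_eq hh.coeFn_toLp] with x hx
    rw [hx, hmul]
  exact ⟨LinearIsometryEquiv.ofSurjective T hsurj, hT⟩

end

variable {n : ℕ} {M : Type*} [TopologicalSpace M] [ChartedSpace (Euc n) M]
  [IsManifold (𝓡 n) ∞ M]

omit [IsManifold (𝓡 n) ∞ M] in
/-- Conjugation by a multiplication operator carries graphs to graphs. -/
theorem image_l2Graph [MeasurableSpace M] {μ ν : Measure M} (hμν : μ ≪ ν) (hνμ : ν ≪ μ)
    {a b : C^∞⟮𝓡 n, M; ℝ⟯} (hab : ∀ x, a x * b x = 1) {P Q : C^∞⟮𝓡 n, M; ℝ⟯ → M → ℝ}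
    (hPQ : ∀ φ x, a x * P (b * φ) x = Q φ x) (U : Lp ℂ 2 ν ≃ₗᵢ[ℂ] Lp ℂ 2 μ)
    (hU : ∀ f, U f =ᵐ[μ] fun x => (a x : ℂ) * f x) :
    Prod.map U U '' l2Graph ν P = l2Graph μ Q := by
  have hba : ∀ u : C^∞⟮𝓡 n, M; ℝ⟯, b * (a * u) = u := fun u => by
    ext x
    change b x * (a x * u x) = u x
    rw [← mul_assoc, mul_comm (b x), hab, one_mul]
  have hcancel : ∀ (x : M) (z w : ℂ), (a x : ℂ) * z = (a x : ℂ) * w → z = w := fun x z w h =>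
    mul_left_cancel₀ (Complex.ofReal_ne_zero.mpr (left_ne_zero_of_mul_eq_one (hab x))) h
  ext p
  constructor
  · rintro ⟨q, ⟨u, v, h1, h2⟩, rfl⟩
    refine ⟨a * u, a * v, ?_, ?_⟩
    · filter_upwards [hU q.1, hμν.ae_eq h1] with x hx hx1
      simp only [Prod.map_fst, hx, hx1, ContMDiffMap.coe_mul, Pi.mul_apply]
      push_cast
      ring
    · filter_upwards [hU q.2, hμν.ae_eq h2] with x hx hx2
      simp only [Prod.map_snd, hx, hx2, ← hPQ, hba]
      push_cast
      ring
  · rintro ⟨u, v, h1, h2⟩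
    -- The preimage comes from `b (u + iv)`; both equations are checked after multiplication by `a`,
    -- which cancels.
    refine ⟨(U.symm p.1, U.symm p.2), ⟨b * u, b * v, ?_, ?_⟩, by simp⟩
    · have h := hU (U.symm p.1)
      rw [LinearIsometryEquiv.apply_symm_apply] at h
      filter_upwards [hνμ.ae_eq h, hνμ.ae_eq h1] with x hx hx1
      refine hcancel x _ _ ?_
      have hx' : (a x : ℂ) * (b x : ℂ) = 1 := by rw [← Complex.ofReal_mul, hab, Complex.ofReal_one]
      rw [← hx, hx1]
      simp only [ContMDiffMap.coe_mul, Pi.mul_apply]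
      push_cast
      linear_combination (-(u x : ℂ) - Complex.I * (v x : ℂ)) * hx'
    · have h := hU (U.symm p.2)
      rw [LinearIsometryEquiv.apply_symm_apply] at h
      filter_upwards [hνμ.ae_eq h, hνμ.ae_eq h2] with x hx hx2
      refine hcancel x _ _ ?_
      rw [← hx, hx2, ← hPQ u x, ← hPQ v x]
      push_cast
      ring

/-! ### Ratios of densities -/

theorem exists_linearIndependent_tangent (x : M) :
    ∃ v : Fin n → TangentSpace (𝓡 n) x, LinearIndependent ℝ v := by
  have h := linearIndependent_coordVec (chart_mem_atlas (Euc n) x)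
    ((chartAt (Euc n) x).map_source (mem_chart_source _ x))
  rw [(chartAt (Euc n) x).left_inv (mem_chart_source _ x)] at h
  exact ⟨_, h⟩

theorem ne_zero_of_density_eq {Ω Ω' : TupleFun n M} (hΩ : IsVolumeDensity Ω) {a : M → ℝ}
    (h : ∀ x v, Ω x v = a x ^ 2 * Ω' x v) (x : M) : a x ≠ 0 := fun h0 => by
  obtain ⟨v, hv⟩ := exists_linearIndependent_tangent (n := n) x
  have := hΩ.pos x v hv
  rw [h, h0] at this
  simp at this

/-- Densities at a point form a line: both scale by `|det A|`, so their ratio on one basis is their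
ratio on every tuple. Smoothness is read off the quotient of coordinate densities, as the bases `b
x` need not vary continuously. -/
theorem exists_density_eq_sq_mul {Ω Ω' : TupleFun n M} (hΩ : IsVolumeDensity Ω)
    (hΩ' : IsVolumeDensity Ω') :
    ∃ a : C^∞⟮𝓡 n, M; ℝ⟯, (∀ x, 0 < a x) ∧ ∀ x v, Ω x v = a x ^ 2 * Ω' x v := by
  let b : ∀ x : M, Module.Basis (Fin n) ℝ (TangentSpace (𝓡 n) x) := fun x =>
    (EuclideanSpace.basisFun (Fin n) ℝ).toBasis
  have hb : ∀ x, 0 < Ω x (b x) := fun x => hΩ.pos x _ (b x).linearIndependent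
  have hb' : ∀ x, 0 < Ω' x (b x) := fun x => hΩ'.pos x _ (b x).linearIndependent
  have hf : ∀ x v, Ω x v = Ω x (b x) / Ω' x (b x) * Ω' x v := fun x v => by
    -- Every tuple is the image of the basis under some linear map; a dependent tuple corresponds to
    -- determinant zero.
    have hv : v = fun i => (b x).constr ℝ v (b x i) := by ext1 i; simp
    rw [hv, hΩ.map_det, hΩ'.map_det]
    field_simp [(hb' x).ne']
  have hpos : ∀ x, 0 < Ω x (b x) / Ω' x (b x) := fun x => div_pos (hb x) (hb' x)
  refine ⟨⟨fun x => √(Ω x (b x) / Ω' x (b x)), ?_⟩, fun x => Real.sqrt_pos.mpr (hpos x),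
    fun x v => ?_⟩
  · refine contMDiff_of_forall_chart fun e he => ContDiffOn.sqrt ?_ fun y _ => (hpos _).ne'
    refine ((hΩ.smooth e he).div (hΩ'.smooth e he)
      fun y hy => (coordDensity_pos hΩ' he hy).ne').congr fun y hy => ?_
    refine (eq_div_iff (coordDensity_pos hΩ' he hy).ne').mpr ?_
    exact (hf _ _).symm
  · change _ = √(Ω x (b x) / Ω' x (b x)) ^ 2 * _
    rw [Real.sq_sqrt (hpos x).le]
    exact hf x v

/-- Finitely many chart domains cover `M`, and on each the two coordinate densities differ by the
factor `a²`. -/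
theorem volMeasure_eq_withDensity [MeasurableSpace M] [BorelSpace M] [CompactSpace M]
    {Ω Ω' : TupleFun n M} (hΩ : IsVolumeDensity Ω) (hΩ' : IsVolumeDensity Ω') {a : M → ℝ}
    (ha : Measurable a) (h : ∀ x v, Ω x v = a x ^ 2 * Ω' x v) :
    volMeasure Ω = (volMeasure Ω').withDensity fun x => ENNReal.ofReal (a x ^ 2) := by
  obtain ⟨t, ht⟩ := isCompact_univ.elim_finite_subcover
    (fun x : M => (chartAt (Euc n) x).source) (fun x => (chartAt (Euc n) x).open_source)
    fun x _ => Set.mem_iUnion.mpr ⟨x, mem_chart_source _ x⟩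
  refine (Measure.ext_iff_of_iUnion_eq_univ
    (s := fun x : t => (chartAt (Euc n) (x : M)).source) ?_).mpr fun x => ?_
  · rw [← Set.univ_subset_iff]
    rwa [Set.iUnion_subtype]
  have he := chart_mem_atlas (Euc n) (x : M)
  rw [restrict_withDensity (chartAt (Euc n) (x : M)).open_source.measurableSet,
    volMeasure_restrict hΩ he, volMeasure_restrict hΩ' he]
  have hf : Measurable fun x => ENNReal.ofReal (a x ^ 2) := (ha.pow_const 2).ennreal_ofReal
  ext A hA
  rw [withDensity_apply _ hA, ← lintegral_indicator_one hA, ← lintegral_indicator hA,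
    lintegral_chartMeasure hΩ he (measurable_one.indicator hA),
    lintegral_chartMeasure hΩ' he (hf.indicator hA)]
  refine lintegral_congr fun y => ?_
  by_cases hy : (chartAt (Euc n) (x : M)).symm y ∈ A
  · rw [Set.indicator_of_mem hy, Set.indicator_of_mem hy, Pi.one_apply, mul_one, coordDensity, h,
      ENNReal.ofReal_mul (sq_nonneg _), mul_comm]
    rfl
  · rw [Set.indicator_of_notMem hy, Set.indicator_of_notMem hy, mul_zero, mul_zero]

/-! ### Gradients of sums and products -/

section

variable {φ ψ : M → ℝ}

theorem grad_add (g : Metric n M) (hφ : ContMDiff (𝓡 n) 𝓘(ℝ, ℝ) ∞ φ)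
    (hψ : ContMDiff (𝓡 n) 𝓘(ℝ, ℝ) ∞ ψ) (x : M) :
    grad g (fun y => φ y + ψ y) x = grad g φ x + grad g ψ x := by
  rw [grad, dAt_add hφ hψ, map_add]; rfl

theorem grad_mul (g : Metric n M) (hφ : ContMDiff (𝓡 n) 𝓘(ℝ, ℝ) ∞ φ)
    (hψ : ContMDiff (𝓡 n) 𝓘(ℝ, ℝ) ∞ ψ) (x : M) :
    grad g (fun y => φ y * ψ y) x = φ x • grad g ψ x + ψ x • grad g φ x := by
  rw [grad, dAt_mul hφ hψ, map_add, map_smul, map_smul]; rfl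

theorem grad_const (g : Metric n M) (c : ℝ) (x : M) : grad g (fun _ => c) x = 0 := by
  rw [grad, dAt_const, map_zero]

theorem grad_const_mul (g : Metric n M) (c : ℝ) (hφ : ContMDiff (𝓡 n) 𝓘(ℝ, ℝ) ∞ φ) (x : M) :
    grad g (fun y => c * φ y) x = c • grad g φ x := by
  rw [grad, dAt_const_mul c hφ, map_smul]; rfl

end

/-! ### The weighted Laplacian -/

section

variable [MeasurableSpace M] [BorelSpace M] [CompactSpace M] [T2Space M]
  {Ω : TupleFun n M}

/-- The operator `s div_Ω ∇`. -/
def weightedLaplacian (s : ℝ) (g : Metric n M) (hΩ : IsVolumeDensity Ω) :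
    C^∞⟮𝓡 n, M; ℝ⟯ →ₗ[ℝ] C^∞⟮𝓡 n, M; ℝ⟯ where
  toFun φ := ⟨fun x => s * divergence Ω (grad g φ) x,
    contMDiff_const.mul (contMDiff_divergence hΩ (isSmoothField_grad g φ.contMDiff))⟩
  map_add' φ ψ := by
    ext x
    change s * divergence Ω (grad g (fun y => φ y + ψ y)) x =
      s * divergence Ω (grad g φ) x + s * divergence Ω (grad g ψ) x
    rw [← mul_add, ← divergence_add hΩ (isSmoothField_grad g φ.contMDiff)
      (isSmoothField_grad g ψ.contMDiff), funext (grad_add g φ.contMDiff ψ.contMDiff)]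
  map_smul' c φ := by
    ext x
    change s * divergence Ω (grad g (fun y => c * φ y)) x = c * (s * divergence Ω (grad g φ) x)
    rw [funext (grad_const_mul g c φ.contMDiff),
      divergence_smul hΩ (isSmoothField_grad g φ.contMDiff) contMDiff_const, dAt_const]
    simp only [LinearMap.zero_apply]
    ring

theorem weightedLaplacian_apply (s : ℝ) (g : Metric n M) (hΩ : IsVolumeDensity Ω)
    (φ : C^∞⟮𝓡 n, M; ℝ⟯) (x : M) :
    weightedLaplacian s g hΩ φ x = s * divergence Ω (grad g φ) x := rfl

/-- The two cross terms `dφ(∇ψ)` and `dψ(∇φ)` of the Leibniz rule coincide. Both the symbol and the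
conjugation formula come from this identity. -/
theorem weightedLaplacian_mul (s : ℝ) (g : Metric n M) (hΩ : IsVolumeDensity Ω)
    (φ ψ : C^∞⟮𝓡 n, M; ℝ⟯) (x : M) :
    weightedLaplacian s g hΩ (φ * ψ) x = φ x * weightedLaplacian s g hΩ ψ x +
      ψ x * weightedLaplacian s g hΩ φ x + 2 * s * g.inner x (grad g φ x) (grad g ψ x) := by
  have hφ := isSmoothField_grad g φ.contMDiff
  have hψ := isSmoothField_grad g ψ.contMDiff
  rw [weightedLaplacian_apply, ContMDiffMap.coe_mul]
  change s * divergence Ω (grad g (fun y => φ y * ψ y)) x = _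
  rw [funext (grad_mul g φ.contMDiff ψ.contMDiff),
    divergence_add hΩ (hψ.smul φ.contMDiff) (hφ.smul ψ.contMDiff),
    divergence_smul hΩ hψ φ.contMDiff, divergence_smul hΩ hφ ψ.contMDiff, ← inner_grad g,
    ← inner_grad g, g.symm x (grad g ψ x), weightedLaplacian_apply, weightedLaplacian_apply]
  ring

/-- With `∇φ` having coordinates `∑ Gⁱʲ ∂ⱼφ`, the product rule gives `s ∑ (Gⁱʲ ∂ᵢ∂ⱼφ + ρ⁻¹ ∂ᵢ(ρ Gⁱʲ)
∂ⱼφ)`, with no term of order zero. -/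
theorem isDiffOpTwo_weightedLaplacian (s : ℝ) (g : Metric n M) (hΩ : IsVolumeDensity Ω) :
    IsDiffOpTwo (weightedLaplacian s g hΩ) := by
  intro e he
  set G : Fin n → Fin n → Euc n → ℝ := fun i j y => (gram g (e.symm y) (coordVec e y))⁻¹ i j
    with hGdef
  have hG : ∀ i j, ContDiffOn ℝ ∞ (G i j) e.target := contDiffOn_gram_inv g he
  have hρ := hΩ.smooth e he
  have hρG : ∀ i j, ContDiffOn ℝ ∞ (fun z => coordDensity Ω e z * G i j z) e.target := fun i j =>
    hρ.mul (hG i j)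
  refine ⟨fun i j y => s * G i j y, fun j y => s * ((coordDensity Ω e y)⁻¹ *
    ∑ i, partialD i (fun z => coordDensity Ω e z * G i j z) y), fun _ => 0,
    fun i j => contDiffOn_const.mul (hG i j), fun j => contDiffOn_const.mul
      ((hρ.inv fun y hy => (coordDensity_pos hΩ he hy).ne').mul
        (ContDiffOn.sum fun i _ => contDiffOn_partialD e.open_target (hρG i j) i)),
    contDiffOn_const, fun φ y hy => ?_⟩
  have hpos := (coordDensity_pos hΩ he hy).ne'
  have hdφ : ∀ j, ContDiffOn ℝ ∞ (partialD j fun z => φ (e.symm z)) e.target := fun j =>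
    contDiffOn_partialD e.open_target (contDiffOn_comp_chart_symm he φ.contMDiff) j
  have hdiff : ∀ {f : Euc n → ℝ}, ContDiffOn ℝ ∞ f e.target → DifferentiableAt ℝ f y :=
    fun hf => (hf.contDiffAt (e.open_target.mem_nhds hy)).differentiableAt (by simp)
  have key : ∀ i, partialD i (fun z => coordDensity Ω e z *
      vecCoord e (e.symm z) (grad g φ (e.symm z)) i) y =
      ∑ j, (coordDensity Ω e y * G i j y * partialD i (partialD j fun z => φ (e.symm z)) y +
        partialD j (fun z => φ (e.symm z)) y *
          partialD i (fun z => coordDensity Ω e z * G i j z) y) := fun i => by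
    have hcongr : Set.EqOn (fun z => coordDensity Ω e z *
        vecCoord e (e.symm z) (grad g φ (e.symm z)) i)
        (fun z => ∑ j, coordDensity Ω e z * G i j z * partialD j (fun z => φ (e.symm z)) z)
        e.target := fun z hz => by
      simp only [vecCoord_grad g he hz φ.contMDiff, Finset.mul_sum, hGdef, mul_assoc]
    rw [partialD_congr e.open_target hcongr hy,
      partialD_sum fun j => (hdiff (hρG i j)).fun_mul (hdiff (hdφ j))]
    exact Finset.sum_congr rfl fun j _ => partialD_mul (hdiff (hρG i j)) (hdiff (hdφ j)) i
  rw [weightedLaplacian_apply, divergence_eq_chartDiv hΩ (isSmoothField_grad g φ.contMDiff) he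
    (e.map_target hy), e.right_inv hy, chartDiv]
  simp only [key, Finset.sum_add_distrib, zero_mul, add_zero, mul_add]
  congr 1
  · simp only [Finset.mul_sum]
    refine Finset.sum_congr rfl fun i _ => Finset.sum_congr rfl fun j _ => ?_
    field_simp
  · rw [Finset.sum_comm]
    simp only [Finset.mul_sum, Finset.sum_mul]
    refine Finset.sum_congr rfl fun i _ => Finset.sum_congr rfl fun j _ => ?_
    ring

theorem isWeightedLaplacian_weightedLaplacian {s : ℝ} (hs : s = 1 ∨ s = -1) (g : Metric n M)
    (hΩ : IsVolumeDensity Ω) : IsWeightedLaplacian s g Ω (weightedLaplacian s g hΩ) where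
  diffOp := isDiffOpTwo_weightedLaplacian s g hΩ
  symbol x φ ψ hφ hψ := by
    rw [weightedLaplacian_mul, hφ, hψ]
    change g.inner x (grad g φ x) (grad g ψ x) = _
    have : s * s = 1 := by rcases hs with rfl | rfl <;> norm_num
    linear_combination (-g.inner x (grad g φ x) (grad g ψ x)) * this
  symmetric φ ψ := by
    -- The Dirichlet form of `g` and `Ω`, manifestly symmetric.
    have key : ∀ φ ψ : C^∞⟮𝓡 n, M; ℝ⟯, ∫ x, φ x * weightedLaplacian s g hΩ ψ x ∂(volMeasure Ω) =
        s * -∫ x, g.inner x (grad g φ x) (grad g ψ x) ∂(volMeasure Ω) := fun φ ψ => by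
      simp only [inner_grad]
      rw [← integral_mul_divergence hΩ (isSmoothField_grad g ψ.contMDiff) φ.contMDiff,
        ← integral_const_mul]
      refine integral_congr_ae (Filter.Eventually.of_forall fun x => ?_)
      simp only [weightedLaplacian_apply]
      ring
    simp only [mul_comm (weightedLaplacian s g hΩ φ _)]
    rw [key, key]
    simp only [g.symm _ (grad g ψ _)]
  const φ hφ := by
    obtain ⟨c, hc⟩ := hφ
    ext x
    -- The zero field is written as `0 • ∇φ` so that the Leibniz rule computes its divergence.
    have h0 : grad g φ = fun x => (0 : ℝ) • grad g φ x := by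
      ext1 x
      rw [show (φ : M → ℝ) = fun _ => c from funext hc, grad_const, smul_zero]
    rw [weightedLaplacian_apply, h0, divergence_smul hΩ (isSmoothField_grad g φ.contMDiff)
      contMDiff_const, dAt_const]
    simp

omit [T2Space M] in
/-- A symmetric operator with vanishing symbol that kills the constants is zero. -/
theorem IsWeightedLaplacian.unique {s : ℝ} (hs : s = 1 ∨ s = -1) {g : Metric n M}
    (hΩ : IsVolumeDensity Ω) {P Q : C^∞⟮𝓡 n, M; ℝ⟯ →ₗ[ℝ] C^∞⟮𝓡 n, M; ℝ⟯}
    (hP : IsWeightedLaplacian s g Ω P) (hQ : IsWeightedLaplacian s g Ω Q) : P = Q := by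
  have := isFiniteMeasure_volMeasure hΩ
  have := isOpenPosMeasure_volMeasure hΩ
  have hint : ∀ φ ψ : C^∞⟮𝓡 n, M; ℝ⟯, Integrable (fun x => φ x * ψ x) (volMeasure Ω) :=
    fun φ ψ => integrable_of_continuous hΩ (φ.contMDiff.continuous.mul ψ.contMDiff.continuous)
  let k : ℝ → C^∞⟮𝓡 n, M; ℝ⟯ := fun c => ⟨fun _ => c, contMDiff_const⟩
  obtain ⟨D, hD⟩ : ∃ D, D = P - Q := ⟨_, rfl⟩
  have hk : ∀ c, D (k c) = 0 := fun c => by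
    rw [hD, LinearMap.sub_apply, hP.const _ ⟨c, fun _ => rfl⟩, hQ.const _ ⟨c, fun _ => rfl⟩,
      sub_zero]
  have hvan : ∀ (x : M) (φ ψ : C^∞⟮𝓡 n, M; ℝ⟯), φ x = 0 → ψ x = 0 → D (φ * ψ) x = 0 :=
    fun x φ ψ hφ hψ => by
      have h := (hP.symbol x φ ψ hφ hψ).symm.trans (hQ.symbol x φ ψ hφ hψ)
      have hs0 : s / 2 ≠ 0 := by rcases hs with rfl | rfl <;> norm_num
      rw [hD]
      exact sub_eq_zero.mpr (mul_left_cancel₀ hs0 h)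
  have hleib : ∀ (φ ψ : C^∞⟮𝓡 n, M; ℝ⟯) (x : M),
      D (φ * ψ) x = φ x * D ψ x + ψ x * D φ x := fun φ ψ x => by
    -- Expansion about the values at `x`: the first product is killed by `hvan` and the last
    -- constant by `hk`.
    have h1 : φ * ψ = (φ - k (φ x)) * (ψ - k (ψ x)) + φ x • ψ + ψ x • φ - k (φ x * ψ x) := by
      ext y
      change φ y * ψ y = (φ y - φ x) * (ψ y - ψ x) + φ x * ψ y + ψ x * φ y - φ x * ψ x
      ring
    rw [h1, map_sub, map_add, map_add, map_smul, map_smul, hk, sub_zero]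
    change D ((φ - k (φ x)) * (ψ - k (ψ x))) x + φ x * D ψ x + ψ x * D φ x = _
    rw [hvan x _ _ (sub_self (φ x)) (sub_self (ψ x)), zero_add]
  have hsymm : ∀ φ ψ : C^∞⟮𝓡 n, M; ℝ⟯,
      ∫ x, D φ x * ψ x ∂(volMeasure Ω) = ∫ x, φ x * D ψ x ∂(volMeasure Ω) := fun φ ψ => by
    have h1 : ∀ x, D φ x * ψ x = P φ x * ψ x - Q φ x * ψ x := fun x => by
      rw [hD, ← sub_mul]; rfl
    have h2 : ∀ x, φ x * D ψ x = φ x * P ψ x - φ x * Q ψ x := fun x => by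
      rw [hD, ← mul_sub]; rfl
    simp only [h1, h2]
    rw [integral_sub (hint _ _) (hint _ _), integral_sub (hint _ _) (hint _ _),
      hP.symmetric, hQ.symmetric]
  have hzero : ∀ φ ψ : C^∞⟮𝓡 n, M; ℝ⟯, ∫ x, D φ x * ψ x ∂(volMeasure Ω) = 0 := fun φ ψ => by
    -- Symmetry against the constant `1`, which `D` kills.
    have h1 : ∫ x, D (φ * ψ) x ∂(volMeasure Ω) = 0 := by
      have h := hsymm (φ * ψ) (k 1)
      rw [hk] at h
      simpa [k] using h
    simp only [hleib] at h1
    rw [integral_add (hint _ _) (hint _ _), ← hsymm] at h1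
    simp only [mul_comm (ψ _)] at h1
    linarith
  refine sub_eq_zero.mp (hD.symm.trans ?_)
  ext φ x
  have hae := (integral_eq_zero_iff_of_nonneg (fun x => mul_self_nonneg (D φ x))
    (hint _ _)).mp (hzero φ (D φ))
  have hc : Continuous fun x => D φ x * D φ x :=
    (D φ).contMDiff.continuous.mul (D φ).contMDiff.continuous
  have h := congrFun (hc.ae_eq_iff_eq (volMeasure Ω) continuous_zero |>.mp hae) x
  exact mul_self_eq_zero.mp h

/-! ### Comparison with the Riemannian Laplacian -/

theorem weightedLaplacian_eq_divGrad_add (s : ℝ) (g : Metric n M) (hΩ : IsVolumeDensity Ω)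
    {a : C^∞⟮𝓡 n, M; ℝ⟯} (ha : ∀ x v, Ω x v = a x ^ 2 * riemDensity g x v)
    (φ : C^∞⟮𝓡 n, M; ℝ⟯) (x : M) :
    weightedLaplacian s g hΩ φ x = s * divGrad g φ x +
      s * (1 / a x ^ 2) * g.inner x (grad g φ x) (grad g (fun y => a y ^ 2) x) := by
  rw [weightedLaplacian_apply, divergence_mul_density (isVolumeDensity_riemDensity g)
    (isSmoothField_grad g φ.contMDiff) (f := fun y => a y ^ 2) (a.contMDiff.pow 2)
    (fun x => pow_ne_zero 2 (ne_zero_of_density_eq hΩ ha x)) ha, ← inner_grad g, g.symm, divGrad]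
  ring

/-- Leibniz leaves the first-order term `2s a ⟨∇b, ∇φ⟩`, while the drift in `Pφ` is `2s a⁻¹ ⟨∇a,
∇φ⟩`. They cancel because `ab = 1` gives `a ∇b = -b ∇a`. -/
theorem mul_weightedLaplacian_mul (s : ℝ) (g : Metric n M) (hΩ : IsVolumeDensity Ω)
    {a b : C^∞⟮𝓡 n, M; ℝ⟯} (ha : ∀ x v, Ω x v = a x ^ 2 * riemDensity g x v)
    (hab : ∀ x, a x * b x = 1) (φ : C^∞⟮𝓡 n, M; ℝ⟯) (x : M) :
    a x * weightedLaplacian s g hΩ (b * φ) x =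
      s * divGrad g φ x + (a x * weightedLaplacian s g hΩ b x) * φ x := by
  have h0 := ne_zero_of_density_eq hΩ ha x
  have hsq : grad g (fun y => a y ^ 2) x = a x • grad g a x + a x • grad g a x := by
    rw [← grad_mul g a.contMDiff a.contMDiff]
    simp only [sq]
  have hone : a x • grad g b x + b x • grad g a x = 0 := by
    rw [← grad_mul g a.contMDiff b.contMDiff]
    simp only [hab, grad_const]
  have hinner : a x * g.inner x (grad g φ x) (grad g b x) +
      b x * g.inner x (grad g φ x) (grad g a x) = 0 := by
    rw [← smul_eq_mul, ← smul_eq_mul, ← map_smul, ← map_smul, ← map_add, hone, map_zero]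
  rw [weightedLaplacian_mul, weightedLaplacian_eq_divGrad_add s g hΩ ha φ, hsq, map_add, map_smul,
    smul_eq_mul, g.symm x (grad g b x)]
  have hb : b x = 1 / a x := by rw [eq_div_iff h0, mul_comm, hab]
  rw [hb] at hinner ⊢
  field_simp at hinner ⊢
  linear_combination (2 * s) * hinner

end

end

end WeightedLaplace

end

/-! ### The main theorem -/

theorem mainTheorem10 {n : ℕ} {M : Type*} [TopologicalSpace M] [ChartedSpace (Euc n) M]
    [IsManifold (𝓡 n) ∞ M] [CompactSpace M] [T2Space M] [MeasurableSpace M] [BorelSpace M]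
    (g : Metric n M) (Ω : TupleFun n M) (hΩ : IsVolumeDensity Ω)
    (s : ℝ) (hs : s = 1 ∨ s = -1) :
    (∃! P : C^∞⟮𝓡 n, M; ℝ⟯ →ₗ[ℝ] C^∞⟮𝓡 n, M; ℝ⟯, IsWeightedLaplacian s g Ω P) ∧
    (∃ a : C^∞⟮𝓡 n, M; ℝ⟯, (∀ x, 0 < a x) ∧ ∀ x v, Ω x v = a x ^ 2 * riemDensity g x v) ∧
    ∀ P : C^∞⟮𝓡 n, M; ℝ⟯ →ₗ[ℝ] C^∞⟮𝓡 n, M; ℝ⟯, IsWeightedLaplacian s g Ω P →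
      ∀ a : C^∞⟮𝓡 n, M; ℝ⟯, (∀ x v, Ω x v = a x ^ 2 * riemDensity g x v) →
        (∀ (φ : C^∞⟮𝓡 n, M; ℝ⟯) (x : M),
          P φ x = s * divGrad g φ x +
            s * (1 / a x ^ 2) * g.inner x (grad g φ x) (grad g (fun y => a y ^ 2) x)) ∧
        ∃ b : C^∞⟮𝓡 n, M; ℝ⟯, (∀ x, a x * b x = 1) ∧
          (∀ (φ : C^∞⟮𝓡 n, M; ℝ⟯) (x : M),
            a x * P (b * φ) x = s * divGrad g φ x + (a x * P b x) * φ x) ∧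
          ∃ U : Lp ℂ 2 (volMeasure Ω) ≃ₗᵢ[ℂ] Lp ℂ 2 (volMeasure (riemDensity g)),
            (∀ f, U f =ᵐ[volMeasure (riemDensity g)] fun x => (a x : ℂ) * f x) ∧
            Prod.map U U '' l2Graph (volMeasure Ω) (fun (φ : C^∞⟮𝓡 n, M; ℝ⟯) x => P φ x) =
              l2Graph (volMeasure (riemDensity g))
                (fun (φ : C^∞⟮𝓡 n, M; ℝ⟯) x => s * divGrad g φ x + (a x * P b x) * φ x) := by
  have hR := isVolumeDensity_riemDensity g
  have hL := isWeightedLaplacian_weightedLaplacian hs g hΩ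
  refine ⟨⟨_, hL, fun P hP => hP.unique hs hΩ hL⟩, exists_density_eq_sq_mul hΩ hR,
    fun P hP a ha => ?_⟩
  -- By uniqueness, everything proved for `s div_Ω ∇` applies to an arbitrary `P`.
  have hPL : P = weightedLaplacian s g hΩ := hP.unique hs hΩ hL
  -- `a` may be negative, but a zero would make `Ω` vanish on a frame; so `a⁻¹` is smooth.
  have ha0 := ne_zero_of_density_eq hΩ ha
  obtain ⟨b, hab⟩ : ∃ b : C^∞⟮𝓡 n, M; ℝ⟯, ∀ x, a x * b x = 1 :=
    ⟨⟨fun x => (a x)⁻¹, a.contMDiff.inv₀ ha0⟩, fun x => mul_inv_cancel₀ (ha0 x)⟩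
  have hconj : ∀ (φ : C^∞⟮𝓡 n, M; ℝ⟯) (x : M),
      a x * P (b * φ) x = s * divGrad g φ x + (a x * P b x) * φ x := by
    rw [hPL]
    exact mul_weightedLaplacian_mul s g hΩ ha hab
  have ham : Measurable a := a.contMDiff.continuous.measurable
  have hvol := volMeasure_eq_withDensity hΩ hR ham ha
  have hac : volMeasure Ω ≪ volMeasure (riemDensity g) := by
    rw [hvol]
    exact withDensity_absolutelyContinuous _ _
  obtain ⟨U, hU⟩ := exists_mul_linearIsometryEquiv ham ha0 hvol
  refine ⟨?_, b, hab, hconj, U, hU, image_l2Graph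
    (absolutelyContinuous_withDensity_sq ham ha0 hvol) hac hab hconj U hU⟩
  rw [hPL]
  exact weightedLaplacian_eq_divGrad_add s g hΩ ha
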